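/- Let $n>m\ge 3$ be integers. Let $L=\mathbb Z e_0\oplus\cdots\oplus\mathbb Z e_n$ with the symmetric bilinear form for which $e_0,\dots,e_n$ are orthogonal, $(e_0|e_0)=-(m-2)$ and $(e_j|e_j)=1$ for $1\le j\le n$. Put $h_0=e_0-e_1-\cdots-e_m$ and $h_k=e_k-e_{k+1}$ for $1\le k\le n-1$. Let $W=\langle s_0,\dots,s_{n-1}\rangle$ be the Coxeter group (Weyl group) of the tree $T_{2,m,n-m}$, in which the nodes $1,\dots,n-1$ form a chain and the node $0$ is joined to the node $m$; thus $s_i^2=1$, $s_is_js_i=s_js_is_j$ if $i,j$ are joined, and $s_is_j=s_js_i$ otherwise. It acts linearly on $L$ and on $\mathfrak h=L\otimes\mathbb C$ by $s_k.x=x-(h_k|x)h_k$, and on $\mathfrak h^*$ by the contragredient action. Write $\varepsilon_j=(e_j|\cdot)$, $\varepsilon_{i,j}=\varepsilon_i-\varepsilon_j$, $\alpha_k=(h_k|\cdot)\in\mathfrak h^*$, and let $\Delta=W\{\alpha_0,\dots,\alpha_{n-1}\}$ be the set of real roots. Let $[x]$ be a nonzero odd holomorphic function on $\mathbb C$ such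 that, for all $x,y,u,v\in\mathbb C$, $$[x+y][x-y][u+v][u-v]=[x+u][x-u][y+v][y-v]-[x+v][x-v][y+u][y-u].$$ For $\alpha\in\mathfrak h^*$ let $[\alpha]$ be the function $h\mapsto[\alpha(h)]$ on $\mathfrak h$. Let $\mathbb K=\mathbb C([\alpha];\alpha\in\Delta)$, a subfield of the field of meromorphic functions on $\mathfrak h$, and let $\mathcal L=\mathbb K(f_1,\dots,f_m;\tau_1,\dots,\tau_n)$ be the field of rational functions in the indeterminates $f_i,\tau_j$. Then there is exactly one action of $W$ on $\mathcal L$ by $\mathbb C$-automorphisms such that $s_k([\alpha])=[s_k.\alpha]$ for all $k$ and all $\alpha\in\Delta$, and, with $s_k$ for $k\ge1$ acting on indices as the transposition $(k,k+1)$, * $s_0(\tau_j)=\tau_jf_j$ for $1\le j\le m$, $s_0(\tau_j)=\tau_j$ for $m<j\le n$, and $s_k(\tau_j)=\tau_{s_k(j)}$ for $1\le k\le n-1$; * $s_0(f_i)=1/f_i$, $s_k(f_i)=f_{s_k(i)}$ for $1\le k\le m-1$, and $s_k(f_i)=f_i$ for $m+1\le k\le n-1$; * $\displaystyle s_m(f_i)=\frac{\tau_m}{\tau_{m+1}}\,\frac{[\alpha_0+\varepsilon_{m,m+1}][\varepsilon_{i,m+1}]f_i-[\alpha_0+\varepsilon_{i,m+1}][\varepsilon_{m,m+1}]f_m}{[\alpha_0][\varepsilon_{i,m}]}$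 for $1\le i\le m-1$, and $\displaystyle s_m(f_m)=\frac{\tau_m}{\tau_{m+1}}f_m$. Let $M=W\{e_1,\dots,e_n\}\subset L$. There is exactly one family $(\tau(\Lambda))_{\Lambda\in M}$ of elements of $\mathcal L$ (the lattice $\tau$-functions) such that $\tau(w.e_n)=w(\tau_n)$ for all $w\in W$. These lattice $\tau$-functions satisfy the following bilinear equations of Hirota–Miwa type. For any mutually distinct indices $i,j,k,l_1,\dots,l_{m-2}\in\{1,\dots,n\}$, put $\Lambda=e_0-e_{l_1}-\cdots-e_{l_{m-2}}$ and $\lambda=(\Lambda|\cdot)=\varepsilon_0-\varepsilon_{l_1}-\cdots-\varepsilon_{l_{m-2}}$. Then $\Lambda-e_i,\Lambda-e_j,\Lambda-e_k\in M$ and $$[\varepsilon_{j,k}][\lambda-\varepsilon_j-\varepsilon_k]\,\tau(e_i)\tau(\Lambda-e_i)+[\varepsilon_{k,i}][\lambda-\varepsilon_k-\varepsilon_i]\,\tau(e_j)\tau(\Lambda-e_j)+[\varepsilon_{i,j}][\lambda-\varepsilon_i-\varepsilon_j]\,\tau(e_k)\tau(\Lambda-e_k)=0.$$ -/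

import Mathlib

open scoped Topology

namespace EllipticCremona

noncomputable section

/-! ## The lattice, its bilinear form and the simple reflections -/

/-- The free module `R e₀ ⊕ R e₁ ⊕ ⋯ ⊕ R eₙ`. For `R = ℤ` this is the lattice `L_{m,n}`; for
`R = ℂ` it is its complexification `𝔥_{m,n}`. -/
abbrev LatticeOver (R : Type) (n : ℕ) : Type := Fin (n + 1) → R

/-- The lattice `L_{m,n}`. -/
abbrev Lat (n : ℕ) : Type := LatticeOver ℤ n

/-- The complex vector space `𝔥_{m,n} = L_{m,n} ⊗ ℂ`. -/
abbrev Cartan (n : ℕ) : Type := LatticeOver ℂ n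

/-- The basis vector `e_j`, for `j = 0, 1, …, n`. -/
def e (R : Type) [CommRing R] {n : ℕ} (j : Fin (n + 1)) : LatticeOver R n := Pi.single j 1

/-- The symmetric bilinear form with orthogonal basis `e₀, …, eₙ`, `(e₀|e₀) = -(m-2)` and
`(e_j|e_j) = 1` for `j = 1, …, n`. -/
def form (R : Type) [CommRing R] (m n : ℕ) :
    LatticeOver R n →ₗ[R] LatticeOver R n →ₗ[R] R :=
  LinearMap.mk₂ R
    (fun x y => -((m : R) - 2) * (x 0 * y 0) + ∑ j : Fin n, x j.succ * y j.succ)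
    (fun x x' y => by
      simp only [Pi.add_apply, add_mul, Finset.sum_add_distrib]; ring)
    (fun c x y => by
      simp only [Pi.smul_apply, smul_eq_mul, mul_assoc, ← Finset.mul_sum]; ring)
    (fun x y y' => by
      simp only [Pi.add_apply, mul_add, Finset.sum_add_distrib]; ring)
    (fun c x y => by
      simp only [Pi.smul_apply, smul_eq_mul, mul_left_comm _ c, ← Finset.mul_sum]; ring)

/-- The vectors `h₀ = e₀ - e₁ - ⋯ - e_m` and `h_k = e_k - e_{k+1}` for `k = 1, …, n-1`. -/
def h (R : Type) [CommRing R] (m : ℕ) {n : ℕ} (k : Fin n) : LatticeOver R n :=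
  if (k : ℕ) = 0 then e R 0 - ∑ j : Fin n, if (j : ℕ) < m then e R j.succ else 0
  else e R k.castSucc - e R k.succ

/-- The simple reflection `x ↦ x - (h_k|x) h_k`. -/
def reflection (R : Type) [CommRing R] (m n : ℕ) (k : Fin n) :
    Module.End R (LatticeOver R n) :=
  LinearMap.id - (form R m n (h R m k)).smulRight (h R m k)

/-! ## The Weyl group -/

/-- Adjacency in the tree `T_{2,m,n-m}`: the nodes `1, …, n-1` form a chain, and the node `0` is
attached to the node `m`. -/
def Adjacent (m : ℕ) (i j : ℕ) : Prop :=
  (i = 0 ∧ j = m) ∨ (j = 0 ∧ i = m) ∨ (1 ≤ i ∧ j = i + 1) ∨ (1 ≤ j ∧ i = j + 1)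

open scoped Classical in
/-- The Coxeter matrix of the tree `T_{2,m,n-m}`, with nodes `0, 1, …, n-1`. -/
def coxeterMatrix (m n : ℕ) : CoxeterMatrix (Fin n) where
  M i j := if i = j then 1 else if Adjacent m i j then 3 else 2
  isSymm := by
    ext i j
    have h1 : Adjacent m j i ↔ Adjacent m i j := by unfold Adjacent; tauto
    change (if j = i then 1 else if Adjacent m j i then 3 else 2) =
      if i = j then 1 else if Adjacent m i j then 3 else 2
    simp only [h1, eq_comm]
  diagonal i := by simp
  off_diagonal i j hij := by
    rw [if_neg hij]; split_ifs <;> decide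

/-- The Weyl group `W_{m,n}`, given by generators and the fundamental relations. -/
abbrev Weyl (m n : ℕ) : Type := (coxeterMatrix m n).Group

/-- The generator `s_k` of `W_{m,n}`. -/
abbrev s (m : ℕ) {n : ℕ} (k : Fin n) : Weyl m n := (coxeterMatrix m n).simple k

section Relations

variable {R : Type} [CommRing R] {m n : ℕ}

theorem form_apply (x y : LatticeOver R n) :
    form R m n x y = -((m : R) - 2) * (x 0 * y 0) + ∑ j : Fin n, x j.succ * y j.succ := rfl

theorem form_comm (x y : LatticeOver R n) : form R m n x y = form R m n y x := by
  simp only [form_apply, mul_comm]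

theorem form_e_zero (y : LatticeOver R n) :
    form R m n (e R 0) y = -((m : R) - 2) * y 0 := by
  simp [form_apply, e]

theorem form_e_succ (j : Fin n) (y : LatticeOver R n) :
    form R m n (e R j.succ) y = y j.succ := by
  simp [form_apply, e, Pi.single_apply, (Fin.succ_ne_zero _).symm]

theorem form_h_zero (k : Fin n) (hk : (k : ℕ) = 0) (y : LatticeOver R n) :
    form R m n (h R m k) y =
      -((m : R) - 2) * y 0 - ∑ j : Fin n, if (j : ℕ) < m then y j.succ else 0 := by
  have h1 : ∀ j : Fin n, form R m n (if (j : ℕ) < m then e R j.succ else 0) y =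
      if (j : ℕ) < m then y j.succ else 0 := by
    intro j
    split_ifs
    · exact form_e_succ j y
    · simp
  rw [h, if_pos hk, map_sub, map_sum, LinearMap.sub_apply, LinearMap.sum_apply, form_e_zero]
  simp only [h1]

theorem form_h_pos (k : Fin n) (hk : (k : ℕ) ≠ 0) (y : LatticeOver R n) :
    form R m n (h R m k) y = y k.castSucc - y k.succ := by
  have h1 : k.castSucc ≠ 0 := by
    intro h0; exact hk (by simpa using congrArg Fin.val h0)
  obtain ⟨l, hl⟩ := Fin.exists_succ_eq.2 h1
  rw [h, if_neg hk, map_sub, LinearMap.sub_apply, ← hl, form_e_succ, form_e_succ]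

theorem h_coord_pos (k : Fin n) (hk : (k : ℕ) ≠ 0) (i : Fin (n + 1)) :
    h R m k i = (if (i : ℕ) = k then 1 else 0) - (if (i : ℕ) = k + 1 then 1 else 0) := by
  rw [h, if_neg hk]
  simp [e, Pi.single_apply, Fin.ext_iff]

theorem h_zero_coord_zero (k : Fin n) (hk : (k : ℕ) = 0) : h R m k 0 = 1 := by
  rw [h, if_pos hk]
  simp only [e, Pi.sub_apply, Finset.sum_apply, Pi.single_eq_same]
  rw [Finset.sum_eq_zero, sub_zero]
  intro j _
  split_ifs <;> simp [(Fin.succ_ne_zero j).symm]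

theorem h_zero_coord_succ (k : Fin n) (hk : (k : ℕ) = 0) (j : Fin n) :
    h R m k j.succ = if (j : ℕ) < m then -1 else 0 := by
  rw [h, if_pos hk]
  simp only [e, Pi.sub_apply, Finset.sum_apply]
  rw [Finset.sum_eq_single j]
  · split_ifs <;> simp
  · intro b _ hb
    split_ifs <;> simp [hb.symm]
  · simp

theorem form_h_self (hmn : m < n) (k : Fin n) : form R m n (h R m k) (h R m k) = 2 := by
  by_cases hk : (k : ℕ) = 0
  · rw [form_h_zero k hk, h_zero_coord_zero k hk]
    have h1 : ∀ j : Fin n, (if (j : ℕ) < m then h R m k j.succ else 0) =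
        if (j : ℕ) < m then -1 else 0 := by
      intro j
      rw [h_zero_coord_succ k hk]; split_ifs <;> rfl
    simp only [h1]
    rw [Fin.sum_univ_eq_sum_range (fun j => if j < m then (-1 : R) else 0) n,
      ← Finset.sum_filter]
    have h2 : (Finset.range n).filter (· < m) = Finset.range m := by
      ext a; simp only [Finset.mem_filter, Finset.mem_range]; omega
    rw [h2]
    simp
  · rw [form_h_pos k hk, h_coord_pos k hk, h_coord_pos k hk]
    simp
    ring

theorem form_h_ne_aux (i j : Fin n) (hi : (i : ℕ) = 0) (hj : (j : ℕ) ≠ 0) :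
    form R m n (h R m i) (h R m j) = if (j : ℕ) = m then -1 else 0 := by
  rw [form_h_zero i hi, h_coord_pos j hj]
  have h1 : ∀ t : Fin n, (if (t : ℕ) < m then h R m j t.succ else 0) =
      (if (t : ℕ) = j - 1 then (if (t : ℕ) < m then 1 else 0) else 0)
        - (if (t : ℕ) = j then (if (t : ℕ) < m then 1 else 0) else 0) := by
    intro t
    rw [h_coord_pos j hj, Fin.val_succ]
    have h2 : (t : ℕ) + 1 = j ↔ (t : ℕ) = j - 1 := by omega
    have h3 : (t : ℕ) + 1 = j + 1 ↔ (t : ℕ) = j := by omega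
    simp only [h2, h3]
    split_ifs <;> simp
  simp only [h1, Finset.sum_sub_distrib]
  rw [Fin.sum_univ_eq_sum_range
      (fun t => if t = (j : ℕ) - 1 then (if t < m then (1 : R) else 0) else 0) n,
    Fin.sum_univ_eq_sum_range
      (fun t => if t = (j : ℕ) then (if t < m then (1 : R) else 0) else 0) n,
    Finset.sum_ite_eq', Finset.sum_ite_eq']
  have hjn := j.2
  have h4 : (j : ℕ) - 1 ∈ Finset.range n := by simp; omega
  have h5 : (j : ℕ) ∈ Finset.range n := by simp
  rw [if_pos h4, if_pos h5]
  have h6 : ¬ (((0 : Fin (n + 1)) : ℕ) = (j : ℕ)) := by simp only [Fin.val_zero]; omega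
  have h7 : ¬ (((0 : Fin (n + 1)) : ℕ) = (j : ℕ) + 1) := by simp only [Fin.val_zero]; omega
  rw [if_neg h6, if_neg h7]
  split_ifs <;> first | omega | simp

theorem form_h_ne (i j : Fin n) (hij : i ≠ j) [Decidable (Adjacent m i j)] :
    form R m n (h R m i) (h R m j) = if Adjacent m i j then -1 else 0 := by
  have hij' : (i : ℕ) ≠ j := fun h0 => hij (Fin.ext h0)
  by_cases hi : (i : ℕ) = 0
  · rw [form_h_ne_aux i j hi (by omega)]
    have h1 : Adjacent m i j ↔ (j : ℕ) = m := by unfold Adjacent; omega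
    simp only [h1]
  · by_cases hj : (j : ℕ) = 0
    · rw [form_comm, form_h_ne_aux j i hj hi]
      have h1 : Adjacent m i j ↔ (i : ℕ) = m := by unfold Adjacent; omega
      simp only [h1]
    · rw [form_h_pos i hi, h_coord_pos j hj, h_coord_pos j hj, Fin.val_castSucc, Fin.val_succ]
      have h1 : Adjacent m i j ↔ (j : ℕ) = i + 1 ∨ (i : ℕ) = j + 1 := by
        unfold Adjacent; omega
      simp only [h1]
      split_ifs <;> first | omega | simp

theorem reflection_apply (k : Fin n) (x : LatticeOver R n) :
    reflection R m n k x = x - form R m n (h R m k) x • h R m k := rfl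

/-- The simple reflections satisfy the fundamental relations. -/
theorem reflection_isLiftable (hmn : m < n) :
    (coxeterMatrix m n).IsLiftable (reflection R m n) := by
  classical
  intro i j
  have hii := form_h_self (R := R) hmn i
  have hjj := form_h_self (R := R) hmn j
  change _ ^ (if i = j then 1 else if Adjacent m i j then 3 else 2) = _
  by_cases hij : i = j
  · subst hij
    rw [if_pos rfl]
    refine LinearMap.ext fun x => ?_
    simp only [pow_one, Module.End.mul_apply, Module.End.one_apply, reflection_apply, map_sub,
      map_smul, hii]
    module
  · have h1 := form_h_ne (R := R) (m := m) i j hij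
    have h2 : form R m n (h R m j) (h R m i) = _ := (form_comm _ _).trans h1
    rw [if_neg hij]
    by_cases ha : Adjacent m i j
    · rw [if_pos ha] at h1 h2 ⊢
      refine LinearMap.ext fun x => ?_
      simp only [pow_succ, pow_zero, one_mul, Module.End.mul_apply, Module.End.one_apply,
        reflection_apply, map_sub, map_smul, hii, hjj, h1, h2]
      module
    · rw [if_neg ha] at h1 h2 ⊢
      refine LinearMap.ext fun x => ?_
      simp only [pow_succ, pow_zero, one_mul, Module.End.mul_apply, Module.End.one_apply,
        reflection_apply, map_sub, map_smul, hii, hjj, h1, h2]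
      module

end Relations

/-- The linear action of `W_{m,n}` on `R e₀ ⊕ ⋯ ⊕ R eₙ` in which `s_k` acts by
`s_k.x = x - (h_k|x) h_k`. -/
def weylRep (R : Type) [CommRing R] {m n : ℕ} (hmn : m < n) :
    Representation R (Weyl m n) (LatticeOver R n) :=
  (coxeterMatrix m n).toCoxeterSystem.lift ⟨reflection R m n, reflection_isLiftable hmn⟩

/-- The orbit `M_{m,n} = W_{m,n}{e₁, …, eₙ}` in the lattice. -/
def orbit {m n : ℕ} (hmn : m < n) : Set (Lat n) :=
  {Λ | ∃ (w : Weyl m n) (j : Fin n), Λ = weylRep ℤ hmn w (e ℤ j.succ)}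

/-- The linear function `(Λ|·)` on `𝔥_{m,n}` attached to a lattice element `Λ`. -/
def pairing (m : ℕ) {n : ℕ} (Λ : Lat n) : Module.Dual ℂ (Cartan n) :=
  form ℂ m n (fun j => (Λ j : ℂ))

/-- The coordinate function `ε_j = (e_j|·)` on `𝔥_{m,n}`, for `j = 0, 1, …, n`. -/
def ε (m : ℕ) {n : ℕ} (j : Fin (n + 1)) : Module.Dual ℂ (Cartan n) := form ℂ m n (e ℂ j)

/-- The simple root `α_k = (h_k|·)`. -/
def simpleRoot (m : ℕ) {n : ℕ} (k : Fin n) : Module.Dual ℂ (Cartan n) := form ℂ m n (h ℂ m k)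

/-- The action of `W_{m,n}` on the dual space `𝔥*_{m,n}`, contragredient to that on `𝔥_{m,n}`. -/
def weylDual {m n : ℕ} (hmn : m < n) :
    Representation ℂ (Weyl m n) (Module.Dual ℂ (Cartan n)) :=
  (weylRep ℂ hmn).dual

/-- On `𝔥*_{m,n}` one has `s_k.λ = λ - ⟨h_k, λ⟩ α_k`. -/
theorem weylDual_s {m n : ℕ} (hmn : m < n) (k : Fin n) (l : Module.Dual ℂ (Cartan n)) :
    weylDual hmn (s m k) l = l - l (h ℂ m k) • simpleRoot m k := by
  have h1 : (s m k)⁻¹ = s m k := (coxeterMatrix m n).toCoxeterSystem.inv_simple k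
  have h2 : weylRep ℂ hmn (s m k) = reflection ℂ m n k :=
    (coxeterMatrix m n).toCoxeterSystem.lift_apply_simple (reflection_isLiftable hmn) k
  refine LinearMap.ext fun x => ?_
  rw [weylDual, Representation.dual_apply, h1, h2, Module.Dual.transpose_apply]
  simp only [LinearMap.comp_apply, reflection_apply, map_sub, map_smul, smul_eq_mul,
    LinearMap.sub_apply, LinearMap.smul_apply, simpleRoot]
  ring

/-- The real roots: the orbit of the simple roots in `𝔥*_{m,n}`. -/
def realRoots {m n : ℕ} (hmn : m < n) : Set (Module.Dual ℂ (Cartan n)) :=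
  {α | ∃ (w : Weyl m n) (k : Fin n), α = weylDual hmn w (simpleRoot m k)}

theorem weylDual_mem {m n : ℕ} (hmn : m < n) (w : Weyl m n) {α : Module.Dual ℂ (Cartan n)}
    (hα : α ∈ realRoots hmn) : weylDual hmn w α ∈ realRoots hmn := by
  obtain ⟨v, k, rfl⟩ := hα
  exact ⟨w * v, k, by rw [map_mul, Module.End.mul_apply]⟩

/-! ## The function `[x]` and the coefficient field -/

/-- The function `[x]`: a nonzero odd holomorphic function on `ℂ` satisfying the Riemann
relation. -/
structure Bracket where
  toFun : ℂ → ℂ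
  holomorphic : Differentiable ℂ toFun
  nonzero : ∃ x, toFun x ≠ 0
  odd : ∀ x, toFun (-x) = -toFun x
  riemann : ∀ x y u v,
    toFun (x + y) * toFun (x - y) * toFun (u + v) * toFun (u - v) =
      toFun (x + u) * toFun (x - u) * toFun (y + v) * toFun (y - v)
        - toFun (x + v) * toFun (x - v) * toFun (y + u) * toFun (y - u)

/-- The ring of holomorphic functions on `𝔥_{m,n}`. -/
def Holo (n : ℕ) : Subalgebra ℂ (Cartan n → ℂ) where
  carrier := {f | AnalyticOnNhd ℂ f Set.univ}
  mul_mem' hf hg := hf.mul hg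
  add_mem' hf hg := hf.add hg
  algebraMap_mem' _ := analyticOnNhd_const

instance holo_noZeroDivisors (n : ℕ) : NoZeroDivisors (Holo n) where
  eq_zero_or_eq_zero_of_mul_eq_zero := by
    rintro ⟨f, hf⟩ ⟨g, hg⟩ hfg
    have hfg' : ∀ x, f x * g x = 0 := fun x => congrFun (congrArg Subtype.val hfg) x
    by_contra hcon
    rw [not_or] at hcon
    obtain ⟨a, ha⟩ : ∃ a, f a ≠ 0 := by
      by_contra hall
      push Not at hall
      exact hcon.1 (Subtype.ext (funext hall))
    have hcont : ContinuousAt f a := (hf a (Set.mem_univ a)).continuousAt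
    have hev : g =ᶠ[𝓝 a] (fun _ => 0) := by
      filter_upwards [hcont.eventually_ne ha] with x hx
      exact (mul_eq_zero.1 (hfg' x)).resolve_left hx
    exact hcon.2 (Subtype.ext (AnalyticOnNhd.eq_of_eventuallyEq hg analyticOnNhd_const hev))

instance holo_isDomain (n : ℕ) : IsDomain (Holo n) := NoZeroDivisors.to_isDomain _

/-- The field of meromorphic functions on `𝔥_{m,n} ≅ ℂ^{n+1}`, as quotients of holomorphic
functions on `𝔥_{m,n}`. -/
abbrev Mero (n : ℕ) : Type := FractionRing (Holo n)

/-- The holomorphic function `[α] : v ↦ [α(v)]` on `𝔥_{m,n}`, for a linear function `α`. -/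
def Bracket.holo (b : Bracket) {n : ℕ} (α : Module.Dual ℂ (Cartan n)) : Holo n :=
  ⟨fun v => b.toFun (α v), fun v _ =>
    (b.holomorphic.analyticAt (α v)).comp (α.toContinuousLinearMap.analyticAt v)⟩

/-- `[α]` as a meromorphic function. -/
def Bracket.mero (b : Bracket) {n : ℕ} (α : Module.Dual ℂ (Cartan n)) : Mero n :=
  algebraMap (Holo n) (Mero n) (b.holo α)

/-- The coefficient field `𝕂 = ℂ([α] ; α a real root)`. -/
def coeffField (b : Bracket) {m n : ℕ} (hmn : m < n) : IntermediateField ℂ (Mero n) :=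
  IntermediateField.adjoin ℂ (b.mero '' realRoots hmn)

/-! ## The field of rational functions in the `f` and `τ` variables -/

/-- The field of rational functions in the indeterminates `f₁, …, f_m` and `τ₁, …, τₙ` over the
field of all meromorphic functions on `𝔥_{m,n}`. -/
abbrev Ambient (m n : ℕ) : Type := FractionRing (MvPolynomial (Fin m ⊕ Fin n) (Mero n))

/-- The indeterminate `f_{i+1}`. -/
def fVar {m n : ℕ} (i : Fin m) : Ambient m n :=
  algebraMap (MvPolynomial (Fin m ⊕ Fin n) (Mero n)) (Ambient m n) (MvPolynomial.X (Sum.inl i))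

/-- The indeterminate `τ_{j+1}`. -/
def τVar {m n : ℕ} (j : Fin n) : Ambient m n :=
  algebraMap (MvPolynomial (Fin m ⊕ Fin n) (Mero n)) (Ambient m n) (MvPolynomial.X (Sum.inr j))

/-- `[α]` as a coefficient in the field of rational functions. -/
def Bracket.coeff (b : Bracket) (m : ℕ) {n : ℕ} (α : Module.Dual ℂ (Cartan n)) : Ambient m n :=
  algebraMap (Mero n) (Ambient m n) (b.mero α)

/-- The field `𝓛 = 𝕂(f₁, …, f_m; τ₁, …, τₙ)`. -/
def tauField (b : Bracket) {m n : ℕ} (hmn : m < n) :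
    IntermediateField (coeffField b hmn) (Ambient m n) :=
  IntermediateField.adjoin (coeffField b hmn) (Set.range fVar ∪ Set.range τVar)

instance tauField_algebra (b : Bracket) {m n : ℕ} (hmn : m < n) : Algebra ℂ (tauField b hmn) :=
  IntermediateField.algebra' (tauField b hmn)

/-- The linear function `ε_{i,j} = ε_i - ε_j`, for the points number `i+1` and `j+1`. -/
def εDiff (m : ℕ) {n : ℕ} (i j : Fin n) : Module.Dual ℂ (Cartan n) := ε m i.succ - ε m j.succ

/-- For `k ≥ 1`, the adjacent transposition exchanging the `k`-th and the `(k+1)`-st element of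
`{1, …, N}`; the elements of `Fin N` are numbered from `0`. -/
def adjSwap {N : ℕ} (k : Fin N) : Equiv.Perm (Fin N) :=
  Equiv.swap ⟨(k : ℕ) - 1, by omega⟩ k

section Elements

variable (b : Bracket) {m n : ℕ} (hmn : m < n)

/-- `f_{i+1}` as an element of `𝓛`. -/
def fElt (i : Fin m) : tauField b hmn :=
  ⟨fVar i, IntermediateField.subset_adjoin _ _ (Or.inl ⟨i, rfl⟩)⟩

/-- `τ_{j+1}` as an element of `𝓛`. -/
def τElt (j : Fin n) : tauField b hmn :=
  ⟨τVar j, IntermediateField.subset_adjoin _ _ (Or.inr ⟨j, rfl⟩)⟩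

/-- `[α]`, for a real root `α`, as an element of `𝓛`. -/
def rootElt (α : Module.Dual ℂ (Cartan n)) (hα : α ∈ realRoots hmn) : tauField b hmn :=
  algebraMap (coeffField b hmn) (tauField b hmn)
    ⟨b.mero α, IntermediateField.subset_adjoin _ _ ⟨α, hα, rfl⟩⟩

/-- An index in `{1, …, m}` regarded as an index in `{1, …, n}`. -/
def point (i : Fin m) : Fin n := Fin.castLE hmn.le i

/-- An action of `W_{m,n}` on `𝓛` by `ℂ`-automorphisms in which the simple reflections `s_k` act on
the generators `[α]`, `τ_j`, `f_i` of `𝓛` by the formulas defining the elliptic Cremona system.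
The variables `f_i` and `τ_j` are numbered from `0` here, the nodes of the tree as usual. -/
structure IsTauAction (ρ : Weyl m n →* (tauField b hmn ≃ₐ[ℂ] tauField b hmn)) : Prop where
  /-- `s_k([α]) = [s_k(α)]`. -/
  root : ∀ (k : Fin n) (α : Module.Dual ℂ (Cartan n)) (hα : α ∈ realRoots hmn),
    ρ (s m k) (rootElt b hmn α hα) =
      rootElt b hmn (weylDual hmn (s m k) α) (weylDual_mem hmn (s m k) hα)
  /-- `s_0(τ_j) = τ_j f_j` for `j = 1, …, m`. -/
  s_zero_τ_le : ∀ k : Fin n, (k : ℕ) = 0 → ∀ i : Fin m,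
    ρ (s m k) (τElt b hmn (point hmn i)) = τElt b hmn (point hmn i) * fElt b hmn i
  /-- `s_0(τ_j) = τ_j` for `j = m+1, …, n`. -/
  s_zero_τ_gt : ∀ k : Fin n, (k : ℕ) = 0 → ∀ j : Fin n, m ≤ (j : ℕ) →
    ρ (s m k) (τElt b hmn j) = τElt b hmn j
  /-- `s_k(τ_j) = τ_{s_k(j)}` for `k = 1, …, n-1`. -/
  s_pos_τ : ∀ k : Fin n, (k : ℕ) ≠ 0 → ∀ j : Fin n,
    ρ (s m k) (τElt b hmn j) = τElt b hmn (adjSwap k j)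
  /-- `s_0(f_i) = 1 / f_i`. -/
  s_zero_f : ∀ k : Fin n, (k : ℕ) = 0 → ∀ i : Fin m,
    ρ (s m k) (fElt b hmn i) = (fElt b hmn i)⁻¹
  /-- `s_k(f_i) = f_{s_k(i)}` for `k = 1, …, m-1`. -/
  s_lt_f : ∀ k : Fin m, (k : ℕ) ≠ 0 → ∀ i : Fin m,
    ρ (s m (point hmn k)) (fElt b hmn i) = fElt b hmn (adjSwap k i)
  /-- `s_k(f_i) = f_i` for `k = m+1, …, n-1`. -/
  s_gt_f : ∀ k : Fin n, m < (k : ℕ) → ∀ i : Fin m,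
    ρ (s m k) (fElt b hmn i) = fElt b hmn i
  /-- The formula for `s_m(f_i)`, `i = 1, …, m-1`. Here `z` is the node `0`, `a` stands for the
  last of the first `m` indices and `c` for the next one, so that `τVar (point hmn a)` is `τ_m`,
  `τVar c` is `τ_{m+1}`, and `c` is also the node `m`. -/
  s_m_f : ∀ z c : Fin n, (z : ℕ) = 0 → (c : ℕ) = m → ∀ a : Fin m, (a : ℕ) + 1 = m →
    ∀ i : Fin m, i ≠ a →
    (ρ (s m c) (fElt b hmn i) : Ambient m n) =
      τVar (point hmn a) / τVar c *
        ((b.coeff m (simpleRoot m z + εDiff m (point hmn a) c) *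
              b.coeff m (εDiff m (point hmn i) c) * fVar i
            - b.coeff m (simpleRoot m z + εDiff m (point hmn i) c) *
              b.coeff m (εDiff m (point hmn a) c) * fVar a) /
          (b.coeff m (simpleRoot m z) * b.coeff m (εDiff m (point hmn i) (point hmn a))))
  /-- `s_m(f_m) = (τ_m / τ_{m+1}) f_m`. -/
  s_m_f_m : ∀ c : Fin n, (c : ℕ) = m → ∀ a : Fin m, (a : ℕ) + 1 = m →
    (ρ (s m c) (fElt b hmn a) : Ambient m n) = τVar (point hmn a) / τVar c * fVar a

/-- The family `(τ(Λ))`, `Λ ∈ M_{m,n}`, of lattice `τ`-functions: `τ(w.eₙ) = w(τₙ)` for all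
`w ∈ W_{m,n}`. -/
def IsLatticeTau (ρ : Weyl m n →* (tauField b hmn ≃ₐ[ℂ] tauField b hmn))
    (τ : orbit hmn → tauField b hmn) : Prop :=
  ∀ (w : Weyl m n) (Λ : orbit hmn) (p : Fin n), (p : ℕ) + 1 = n →
    (Λ : Lat n) = weylRep ℤ hmn w (e ℤ p.succ) → τ Λ = ρ w (τElt b hmn p)

end Elements

theorem e_mem_orbit {m n : ℕ} (hmn : m < n) (j : Fin n) : e ℤ j.succ ∈ orbit hmn :=
  ⟨1, j, by rw [map_one, Module.End.one_apply]⟩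

end

end EllipticCremona

namespace EllipticCremona

noncomputable section

/-! ## Semilinear endomorphisms of rational function fields -/

/-! The action is built on the field of rational functions in the f and τ variables over all
meromorphic functions on 𝔥, and then restricted to 𝓛. On the large field [α] is a nonzero constant
for every α ≠ 0, root or not, so the identities can be verified without keeping track of roots. The
formulas for s_k extend to a semilinear endomorphism because the variables are rational in their
prescribed images, which are therefore algebraically independent by a count of transcendence degree
(`exists_semilinear_endomorphism`, `CremonaData.mem_of_image_mem`).

The Coxeter relations have to be checked only on coefficients, where they come from the linear
action, and on the variables. The formula for s_m(f_i) is a two-point interpolation `interp`: as a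
function of z it has the value F at z = y and G at z = x. By the Riemann relation, sampling this
function at a new point z instead of y, with α replaced by α + (y - z), determines the same function
(`interp_interp_right`). This gives s_m² = 1 and the braid relation of s_m and s_{m+1}. A
cancellation that needs no addition formula (`interp_interp_left`) is the further ingredient for
s_{m-1} and s_m, and the behaviour of `interp` under inversion of the values (`interp_inv`) settles
s_0 and s_m. All brackets in the formulas are taken at real roots, so 𝓛 is stable. The action is
unique because 𝓛 is generated over ℂ by these brackets and the variables.

For the lattice τ-functions the point is the stabilizer of e_n. The vector e_n pairs nonpositively
with every h_k, and to zero unless k = n-1. Since w.h_k lies in the positive cone whenever s_k is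
not a right descent of w (`weylRep_h_mem_positiveCone`), the stabilizer is generated by the s_k with
k ≠ n-1 (`stabilizer_induction`). All of these fix τ_n.

For the bilinear equations, a permutation of the indices, which comes from W, moves l_1, …, l_{m-2},
i, j, k to 1, …, m+1. There Λ - e_{m-1} = s_0.e_m, Λ - e_m = s_0.e_{m-1} and Λ - e_{m+1} = s_m
s_0.e_{m-1}. The corresponding τ-functions are τ_m f_m, τ_{m-1} f_{m-1} and τ_{m-1} s_m(f_{m-1}), so
the equation is the formula for s_m(f_{m-1}) with denominators cleared. -/

/-- If the members of a finite transcendence basis are rational expressions in a family of the same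
size, then that family is algebraically independent. -/
theorem algebraicIndependent_of_mem_adjoin {ι F K : Type*} [Finite ι] [Field F] [Field K]
    [Algebra F K] {x y : ι → K} (hx : IsTranscendenceBasis F x)
    (hy : ∀ i, x i ∈ IntermediateField.adjoin F (Set.range y)) : AlgebraicIndependent F y := by
  have halg : ∀ z ∈ IntermediateField.adjoin F (Set.range y),
      IsAlgebraic (Algebra.adjoin F (Set.range y)) z := by
    intro z hz
    induction hz using IntermediateField.adjoin_induction with
    | mem z hz =>
      exact isAlgebraic_algebraMap (⟨z, Algebra.subset_adjoin hz⟩ : Algebra.adjoin F (Set.range y))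
    | algebraMap c =>
      exact isAlgebraic_algebraMap
        (⟨_, Subalgebra.algebraMap_mem _ c⟩ : Algebra.adjoin F (Set.range y))
    | add _ _ _ _ h1 h2 => exact h1.add h2
    | inv _ _ h1 => exact h1.inv
    | mul _ _ _ _ h1 h2 => exact h1.mul h2
  have hspan : (AlgebraicIndependent.matroid F K).Spanning (Set.range y) := by
    have h1 : (AlgebraicIndependent.matroid F K).Spanning (Set.range x) :=
      AlgebraicIndependent.matroid_spanning_iff.2 hx.isAlgebraic
    refine (Matroid.spanning_iff_closure_eq (by simp)).2 ?_
    refine Set.Subset.antisymm (Matroid.closure_subset_ground _ _) ?_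
    rw [← h1.closure_eq]
    refine Matroid.closure_subset_closure_of_subset_closure ?_
    rw [AlgebraicIndependent.matroid_closure_eq]
    rintro _ ⟨i, rfl⟩
    exact halg _ (hy i)
  have : Algebra.IsAlgebraic (Algebra.adjoin F (Set.range y)) K :=
    AlgebraicIndependent.matroid_spanning_iff.1 hspan
  -- A spanning family contains a transcendence basis `t`, which has as many elements as `ι`. The
  -- range of `y` has no more than that, so it coincides with `t`, and `y` cannot repeat a value.
  obtain ⟨t, hty, ht⟩ := exists_isTranscendenceBasis_subset (R := F) (A := K) (Set.range y)
  have hcard := ht.lift_cardinalMk_eq hx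
  have hfin : (Set.range y).Finite := Set.finite_range y
  have htf : t.Finite := hfin.subset hty
  have hnc : t.ncard = Nat.card ι := by
    have h2 := congrArg Cardinal.toNat hcard
    rw [Cardinal.toNat_lift, Cardinal.toNat_lift] at h2
    exact h2
  have hle : Nat.card (Set.range y) ≤ Nat.card ι := Nat.card_le_card_of_surjective _
    Set.rangeFactorization_surjective
  have hteq : t = Set.range y := by
    refine Set.eq_of_subset_of_ncard_le hty ?_ hfin
    rw [hnc]; exact hle
  have hinj : Function.Injective y := by
    have h3 : Nat.card (Set.range y) = Nat.card ι := by
      rw [← hnc, hteq]; rfl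
    have := Fintype.ofFinite ι
    have h5 : Function.Bijective (Set.rangeFactorization y) :=
      (Nat.bijective_iff_surjective_and_card _).2 ⟨Set.rangeFactorization_surjective, h3.symm⟩
    intro a c hac
    exact h5.1 (Subtype.ext hac)
  subst hteq
  exact (algebraicIndependent_subtype_range hinj).1 ht.1

/-- An endomorphism of the coefficient field extends to the field of rational functions with
prescribed values on the variables, provided the variables are rational in these values. -/
theorem exists_semilinear_endomorphism {ι F K : Type*} [Finite ι] [Field F] [Field K]
    [Algebra (MvPolynomial ι F) K] [IsFractionRing (MvPolynomial ι F) K] [Algebra F K]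
    [IsScalarTower F (MvPolynomial ι F) K] (σ : F →+* F) (y : ι → K)
    (hy : ∀ i, algebraMap (MvPolynomial ι F) K (MvPolynomial.X i) ∈
      IntermediateField.adjoin F (Set.range y)) :
    ∃ φ : K →+* K, (∀ c, φ (algebraMap F K c) = algebraMap F K (σ c)) ∧
      ∀ i, φ (algebraMap (MvPolynomial ι F) K (MvPolynomial.X i)) = y i := by
  have halg : Algebra.IsAlgebraic (MvPolynomial ι F) K :=
    (IsFractionRing.comap_isAlgebraic_iff (A := MvPolynomial ι F) (K := K) (C := K)).2 inferInstance
  have hx : IsTranscendenceBasis F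
      (algebraMap (MvPolynomial ι F) K ∘ (MvPolynomial.X : ι → MvPolynomial ι F)) :=
    (IsTranscendenceBasis.mvPolynomial ι F).algebraMap_comp
  have hind := algebraicIndependent_of_mem_adjoin hx hy
  -- Twist the coefficients by `σ`, then substitute `y`. Both maps are injective, the second by
  -- algebraic independence, so the composite extends to fractions.
  let g : MvPolynomial ι F →+* K := (MvPolynomial.aeval y).toRingHom.comp (MvPolynomial.map σ)
  have hg : Function.Injective g :=
    Function.Injective.comp (g := MvPolynomial.aeval y) hind
      (MvPolynomial.map_injective σ σ.injective)
  refine ⟨IsFractionRing.lift hg, fun c => ?_, fun i => ?_⟩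
  · rw [IsScalarTower.algebraMap_apply F (MvPolynomial ι F) K, IsFractionRing.lift_algebraMap]
    simp [g, MvPolynomial.algebraMap_eq]
  · rw [IsFractionRing.lift_algebraMap]
    simp [g]

/-- Two endomorphisms of a field of rational functions agree if they agree on the coefficients and
on the variables. -/
theorem ringHom_ext_rational {ι F K : Type*} [Field F] [Field K]
    [Algebra (MvPolynomial ι F) K] [IsFractionRing (MvPolynomial ι F) K] [Algebra F K]
    [IsScalarTower F (MvPolynomial ι F) K] {φ ψ : K →+* K}
    (hC : ∀ c, φ (algebraMap F K c) = ψ (algebraMap F K c))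
    (hX : ∀ i, φ (algebraMap (MvPolynomial ι F) K (MvPolynomial.X i)) =
      ψ (algebraMap (MvPolynomial ι F) K (MvPolynomial.X i))) : φ = ψ := by
  have h1 : φ.comp (algebraMap (MvPolynomial ι F) K) = ψ.comp (algebraMap (MvPolynomial ι F) K) := by
    refine MvPolynomial.ringHom_ext (fun c => ?_) hX
    have := hC c
    rwa [IsScalarTower.algebraMap_apply F (MvPolynomial ι F) K] at this
  exact IsFractionRing.ringHom_ext fun x => RingHom.congr_fun h1 x

/-! ## The action on meromorphic functions -/

section Coefficients

variable {m n : ℕ} (hmn : m < n)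

/-- Precomposition of holomorphic functions with a linear map. -/
def holoComp {n : ℕ} (g : Cartan n →ₗ[ℂ] Cartan n) : Holo n →ₐ[ℂ] Holo n where
  toFun f := ⟨fun v => f.1 (g v), fun v _ =>
    (f.2 (g v) (Set.mem_univ _)).comp (g.toContinuousLinearMap.analyticAt v)⟩
  map_one' := rfl
  map_mul' _ _ := rfl
  map_zero' := rfl
  map_add' _ _ := rfl
  commutes' _ := rfl

/-- The action of the Weyl group on holomorphic functions. -/
def weylHolo : Weyl m n →* (Holo n ≃ₐ[ℂ] Holo n) where
  toFun w := AlgEquiv.ofAlgHom (holoComp (weylRep ℂ hmn w⁻¹)) (holoComp (weylRep ℂ hmn w))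
    (by
      refine AlgHom.ext fun f => Subtype.ext (funext fun v => ?_)
      change f.1 (weylRep ℂ hmn w (weylRep ℂ hmn w⁻¹ v)) = f.1 v
      rw [← Module.End.mul_apply, ← map_mul, mul_inv_cancel, map_one, Module.End.one_apply])
    (by
      refine AlgHom.ext fun f => Subtype.ext (funext fun v => ?_)
      change f.1 (weylRep ℂ hmn w⁻¹ (weylRep ℂ hmn w v)) = f.1 v
      rw [← Module.End.mul_apply, ← map_mul, inv_mul_cancel, map_one, Module.End.one_apply])
  map_one' := by
    refine AlgEquiv.ext fun f => Subtype.ext (funext fun v => ?_)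
    change f.1 (weylRep ℂ hmn 1⁻¹ v) = f.1 v
    rw [inv_one, map_one, Module.End.one_apply]
  map_mul' u w := by
    refine AlgEquiv.ext fun f => Subtype.ext (funext fun v => ?_)
    change f.1 (weylRep ℂ hmn (u * w)⁻¹ v) = f.1 (weylRep ℂ hmn w⁻¹ (weylRep ℂ hmn u⁻¹ v))
    rw [mul_inv_rev, map_mul, Module.End.mul_apply]

/-- The action of the Weyl group on meromorphic functions. -/
def weylMero : Weyl m n →* (Mero n ≃ₐ[ℂ] Mero n) :=
  (IsFractionRing.fieldEquivOfAlgEquivHom (A := ℂ) (B := Holo n) ℂ (Mero n)).comp (weylHolo hmn)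

/-- Functions and linear forms are both acted on by precomposition with w⁻¹, so on holomorphic
functions the two sides agree by definition. -/
theorem weylMero_mero (b : Bracket) (w : Weyl m n) (α : Module.Dual ℂ (Cartan n)) :
    weylMero hmn w (b.mero α) = b.mero (weylDual hmn w α) := by
  change IsFractionRing.fieldEquivOfAlgEquiv ℂ (Mero n) (Mero n) (weylHolo hmn w) (b.mero α) = _
  rw [Bracket.mero, IsFractionRing.fieldEquivOfAlgEquiv_algebraMap]
  rfl

end Coefficients

/-! ### Brackets as coefficients: nonvanishing and the Riemann relation. -/

section BracketFacts

variable (b : Bracket) (m : ℕ) {n : ℕ}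

/-- Holomorphic functions as coefficients in the field of rational functions. -/
def holoHom (m n : ℕ) : Holo n →+* Ambient m n :=
  (algebraMap (Mero n) (Ambient m n)).comp (algebraMap (Holo n) (Mero n))

theorem Bracket.coeff_eq (α : Module.Dual ℂ (Cartan n)) :
    b.coeff m α = holoHom m n (b.holo α) := rfl

theorem Bracket.coeff_neg (α : Module.Dual ℂ (Cartan n)) : b.coeff m (-α) = -b.coeff m α := by
  have h1 : b.holo (-α) = -b.holo α := Subtype.ext (funext fun v => b.odd (α v))
  rw [Bracket.coeff_eq, h1, RingHom.map_neg, Bracket.coeff_eq]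

/-- A nonzero linear form is surjective onto ℂ, so it attains a point where the bracket function
does not vanish. -/
theorem Bracket.coeff_ne_zero {α : Module.Dual ℂ (Cartan n)} (hα : α ≠ 0) : b.coeff m α ≠ 0 := by
  have h1 : b.holo α ≠ 0 := by
    intro h0
    obtain ⟨x, hx⟩ := b.nonzero
    obtain ⟨v, hv⟩ := LinearMap.surjective hα x
    refine hx ?_
    rw [← hv]
    exact congrFun (congrArg Subtype.val h0) v
  intro h2
  refine h1 ((IsFractionRing.injective (Holo n) (Mero n)) ?_)
  rw [map_zero]
  exact (algebraMap (Mero n) (Ambient m n)).injective (by rw [map_zero]; exact h2)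

theorem Bracket.coeff_riemann (x y u v : Module.Dual ℂ (Cartan n)) :
    b.coeff m (x + y) * b.coeff m (x - y) * b.coeff m (u + v) * b.coeff m (u - v) =
      b.coeff m (x + u) * b.coeff m (x - u) * b.coeff m (y + v) * b.coeff m (y - v)
        - b.coeff m (x + v) * b.coeff m (x - v) * b.coeff m (y + u) * b.coeff m (y - u) := by
  have h1 : b.holo (x + y) * b.holo (x - y) * b.holo (u + v) * b.holo (u - v) =
      b.holo (x + u) * b.holo (x - u) * b.holo (y + v) * b.holo (y - v)
        - b.holo (x + v) * b.holo (x - v) * b.holo (y + u) * b.holo (y - u) :=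
    Subtype.ext (funext fun t => b.riemann (x t) (y t) (u t) (v t))
  simp only [Bracket.coeff_eq, ← RingHom.map_mul, ← RingHom.map_sub, h1]

/-- The Riemann relation in a form without halves. -/
theorem Bracket.coeff_riemann' (α x y z u : Module.Dual ℂ (Cartan n)) :
    b.coeff m (α + (x - u) + (y - z)) * b.coeff m (x - y) * b.coeff m α * b.coeff m (z - u) =
      b.coeff m (α + (x - u)) * b.coeff m (x - z) * b.coeff m (α + (y - z)) * b.coeff m (y - u)
        - b.coeff m (α + (x - z)) * b.coeff m (x - u) * b.coeff m (α + (y - u)) *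
          b.coeff m (y - z) := by
  -- These half-sums solve X + U = α + (x - u), X - U = x - z, Y + V = α + (y - z), Y - V = y - u.
  -- The halves live in the complex dual space and disappear from all sums and differences below.
  obtain ⟨X, hX⟩ : ∃ X, X = (1 / 2 : ℂ) • (α + (2 : ℂ) • x - z - u) := ⟨_, rfl⟩
  obtain ⟨Y, hY⟩ : ∃ Y, Y = (1 / 2 : ℂ) • (α + (2 : ℂ) • y - z - u) := ⟨_, rfl⟩
  obtain ⟨U, hU⟩ : ∃ U, U = (1 / 2 : ℂ) • (α + z - u) := ⟨_, rfl⟩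
  obtain ⟨V, hV⟩ : ∃ V, V = (1 / 2 : ℂ) • (α - z + u) := ⟨_, rfl⟩
  have h1 := b.coeff_riemann m X Y U V
  have e1 : X + Y = α + (x - u) + (y - z) := by rw [hX, hY]; module
  have e2 : X - Y = x - y := by rw [hX, hY]; module
  have e3 : U + V = α := by rw [hU, hV]; module
  have e4 : U - V = z - u := by rw [hU, hV]; module
  have e5 : X + U = α + (x - u) := by rw [hX, hU]; module
  have e6 : X - U = x - z := by rw [hX, hU]; module
  have e7 : Y + V = α + (y - z) := by rw [hY, hV]; module
  have e8 : Y - V = y - u := by rw [hY, hV]; module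
  have e9 : X + V = α + (x - z) := by rw [hX, hV]; module
  have e10 : X - V = x - u := by rw [hX, hV]; module
  have e11 : Y + U = α + (y - u) := by rw [hY, hU]; module
  have e12 : Y - U = y - z := by rw [hY, hU]; module
  rwa [e1, e2, e3, e4, e5, e6, e7, e8, e9, e10, e11, e12] at h1

end BracketFacts

/-! ## Simple reflections on the coordinate functions -/

theorem adjSwap_val {N : ℕ} (k j : Fin N) : (adjSwap k j : ℕ) =
    if (j : ℕ) = k - 1 then (k : ℕ) else if (j : ℕ) = k then (k : ℕ) - 1 else j := by
  rw [adjSwap, Equiv.swap_apply_def]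
  simp only [Fin.ext_iff]
  split_ifs <;> rfl

theorem adjSwap_adjSwap {N : ℕ} (k j : Fin N) : adjSwap k (adjSwap k j) = j :=
  Equiv.swap_apply_self _ _ _

theorem adjSwap_comm {N : ℕ} {k l : Fin N} (hkl : (k : ℕ) + 1 < l) (j : Fin N) :
    adjSwap k (adjSwap l j) = adjSwap l (adjSwap k j) := by
  apply Fin.ext
  simp only [adjSwap_val]
  split_ifs <;> omega

theorem adjSwap_braid {N : ℕ} {k l : Fin N} (hk : (k : ℕ) ≠ 0) (hkl : (l : ℕ) = k + 1)
    (j : Fin N) :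
    adjSwap k (adjSwap l (adjSwap k j)) = adjSwap l (adjSwap k (adjSwap l j)) := by
  obtain ⟨p, hp⟩ : ∃ p : Fin N, p = ⟨(k : ℕ) - 1, by omega⟩ := ⟨_, rfl⟩
  have h1 : adjSwap k = Equiv.swap p k := by rw [hp]; rfl
  have h2 : adjSwap l = Equiv.swap k l := by
    rw [adjSwap]; congr 1; exact Fin.ext (by simp only; omega)
  have hpk : p ≠ k := fun h0 => by
    have := congrArg Fin.val h0
    rw [hp] at this
    simp only at this
    omega
  have hpl : p ≠ l := fun h0 => by
    have := congrArg Fin.val h0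
    rw [hp] at this
    simp only at this
    omega
  have hkl' : k ≠ l := fun h0 => by have := congrArg Fin.val h0; omega
  have h3 := Equiv.swap_mul_swap_mul_swap (x := l) (y := k) (z := p) hkl'.symm hpl.symm
  have h4 := Equiv.swap_mul_swap_mul_swap (x := p) (y := k) (z := l) hpk hpl
  rw [Equiv.swap_comm k p, Equiv.swap_comm l k] at h3
  rw [Equiv.swap_comm l p] at h4
  have h5 := DFunLike.congr_fun (h3.trans h4.symm) j
  rw [h1, h2]
  exact h5

section Coordinates

variable {m n : ℕ}

theorem simpleRoot_pos (k : Fin n) (hk : (k : ℕ) ≠ 0) :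
    simpleRoot m k = ε m k.castSucc - ε m k.succ := by
  rw [simpleRoot, h, if_neg hk, map_sub]; rfl

theorem ε_succ_apply (j : Fin n) (v : Cartan n) : ε m j.succ v = v j.succ := form_e_succ j v

theorem ε_sub_ne_zero {i j : Fin n} (hij : i ≠ j) : ε m i.succ - ε m j.succ ≠ 0 := by
  intro h0
  have h1 := LinearMap.congr_fun h0 (e ℂ i.succ)
  rw [LinearMap.sub_apply, ε_succ_apply, ε_succ_apply] at h1
  simp [e, Fin.succ_inj, hij.symm] at h1

theorem simpleRoot_zero_ne_zero (hmn : m < n) (z : Fin n) : simpleRoot m z ≠ 0 := by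
  intro h0
  have h1 := LinearMap.congr_fun h0 (h ℂ m z)
  rw [simpleRoot, form_h_self hmn] at h1
  norm_num at h1

variable (hmn : m < n)

theorem weylDual_ε_pos (k : Fin n) (hk : (k : ℕ) ≠ 0) (j : Fin n) :
    weylDual hmn (s m k) (ε m j.succ) = ε m (adjSwap k j).succ := by
  rw [weylDual_s, ε_succ_apply, h_coord_pos k hk, simpleRoot_pos k hk, Fin.val_succ]
  have hv := adjSwap_val k j
  by_cases h1 : (j : ℕ) = k - 1
  · rw [if_pos h1] at hv
    have h2 : adjSwap k j = k := Fin.ext hv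
    have h3 : k.castSucc = j.succ := Fin.ext (by simp; omega)
    rw [if_pos (by omega), if_neg (by omega), h2, h3]
    module
  · by_cases h2 : (j : ℕ) = k
    · rw [if_neg h1, if_pos h2] at hv
      have h3 : k.castSucc = (adjSwap k j).succ := Fin.ext (by simp; omega)
      have h4 : j = k := Fin.ext h2
      rw [if_neg (by omega), if_pos (by omega), h3, h4]
      module
    · rw [if_neg h1, if_neg h2] at hv
      rw [if_neg (by omega), if_neg (by omega), Fin.ext hv]
      module

theorem weylDual_zero_ε_lt (z : Fin n) (hz : (z : ℕ) = 0) (j : Fin n) (hj : (j : ℕ) < m) :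
    weylDual hmn (s m z) (ε m j.succ) = ε m j.succ + simpleRoot m z := by
  rw [weylDual_s, ε_succ_apply, h_zero_coord_succ z hz, if_pos hj]
  module

theorem weylDual_zero_ε_ge (z : Fin n) (hz : (z : ℕ) = 0) (j : Fin n) (hj : m ≤ (j : ℕ)) :
    weylDual hmn (s m z) (ε m j.succ) = ε m j.succ := by
  rw [weylDual_s, ε_succ_apply, h_zero_coord_succ z hz, if_neg (by omega)]
  module

theorem weylDual_simpleRoot_self (k : Fin n) :
    weylDual hmn (s m k) (simpleRoot m k) = -simpleRoot m k := by
  rw [weylDual_s, simpleRoot, form_h_self hmn]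
  module

theorem weylDual_simpleRoot_zero_of_ne (z k : Fin n) (hz : (z : ℕ) = 0) (hk : (k : ℕ) ≠ 0)
    (hkm : (k : ℕ) ≠ m) : weylDual hmn (s m k) (simpleRoot m z) = simpleRoot m z := by
  rw [weylDual_s, simpleRoot, form_h_ne_aux z k hz hk, if_neg hkm]
  module

theorem weylDual_simpleRoot_zero_m (z a c : Fin n) (hz : (z : ℕ) = 0) (hc : (c : ℕ) = m)
    (ha : (a : ℕ) + 1 = m) :
    weylDual hmn (s m c) (simpleRoot m z) =
      simpleRoot m z + (ε m a.succ - ε m c.succ) := by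
  have h1 : c.castSucc = a.succ := Fin.ext (by simp; omega)
  rw [weylDual_s, simpleRoot_pos c (by omega), simpleRoot, form_h_ne_aux z c hz (by omega),
    if_pos hc, h1]
  module

theorem weylDual_injective (w : Weyl m n) : Function.Injective (weylDual hmn w) := by
  refine Function.LeftInverse.injective (g := weylDual hmn w⁻¹) fun v => ?_
  rw [← Module.End.mul_apply, ← map_mul, inv_mul_cancel, map_one, Module.End.one_apply]

end Coordinates

/-! ## The elementary transformation of the `f` variables -/

section Interpolation

variable {V K : Type*} [AddCommGroup V] [Field K]

/-- The linear interpolation formula in the action of `s_m` on the `f` variables. -/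
def interp (br : V → K) (α x y z : V) (F G : K) : K :=
  (br (α + (y - z)) * br (x - z) * F - br (α + (x - z)) * br (y - z) * G) / (br α * br (x - y))

theorem map_interp {br : V → K} {φ : K →+* K} {d : V →+ V} (h : ∀ v, φ (br v) = br (d v))
    (α x y z : V) (F G : K) :
    φ (interp br α x y z F G) = interp br (d α) (d x) (d y) (d z) (φ F) (φ G) := by
  simp only [interp, map_div₀, map_sub, map_mul, map_add, h]

theorem interp_mul (br : V → K) (α x y z : V) (T F G : K) :
    interp br α x y z (T * F) (T * G) = T * interp br α x y z F G := by
  simp only [interp]; ring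

theorem interp_mem {br : V → K} {S : Subfield K} {α x y z : V} {F G : K} (h0 : br α ∈ S)
    (h1 : br (α + (y - z)) ∈ S) (h2 : br (x - z) ∈ S) (h3 : br (α + (x - z)) ∈ S)
    (h4 : br (y - z) ∈ S) (h5 : br (x - y) ∈ S) (hF : F ∈ S) (hG : G ∈ S) :
    interp br α x y z F G ∈ S :=
  div_mem (sub_mem (mul_mem (mul_mem h1 h2) hF) (mul_mem (mul_mem h3 h4) hG)) (mul_mem h0 h5)

theorem br_sub_swap {br : V → K} (hodd : ∀ v, br (-v) = -br v) (x y : V) :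
    br (x - y) = -br (y - x) := by rw [← neg_sub, hodd]

theorem interp_swap {br : V → K} (hodd : ∀ v, br (-v) = -br v) (α x y z : V) (F G : K) :
    interp br α y x z G F = interp br α x y z F G := by
  simp only [interp]
  rw [br_sub_swap hodd y x, mul_neg, div_neg, ← neg_div]
  ring

/-- Shifting both nodes by α and changing the sign of α exchanges the two bracket factors within
each numerator term, while F⁻¹ = G / (F G) exchanges the values. The signs from the reordered
numerator and from [-α] cancel. This is the effect of s_0 on the formula for s_m. -/
theorem interp_inv {br : V → K} (hodd : ∀ v, br (-v) = -br v) {α x y z : V} {F G : K}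
    (hF : F ≠ 0) (hG : G ≠ 0) :
    interp br (-α) (x + α) (y + α) z F⁻¹ G⁻¹ = interp br α x y z F G / (F * G) := by
  have e1 : -α + (y + α - z) = y - z := by abel
  have e2 : -α + (x + α - z) = x - z := by abel
  have e3 : x + α - (y + α) = x - y := by abel
  have e4 : x + α - z = α + (x - z) := by abel
  have e5 : y + α - z = α + (y - z) := by abel
  have h1 : br (y - z) * br (α + (x - z)) * F⁻¹ - br (x - z) * br (α + (y - z)) * G⁻¹ =
      -((br (α + (y - z)) * br (x - z) * F - br (α + (x - z)) * br (y - z) * G) / (F * G)) := by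
    field_simp
    ring
  simp only [interp]
  rw [e1, e2, e3, e4, e5, h1, hodd, neg_mul, neg_div_neg_eq, div_right_comm]

/-- Composition of interpolations along the exchange of two of the first points. -/
theorem interp_interp_left {br : V → K} {α x w y z : V} (hα : br α ≠ 0) (h1 : br (α + (y - z)) ≠ 0)
    (h2 : br (x - y) ≠ 0) (h3 : br (w - y) ≠ 0) (h4 : br (x - w) ≠ 0) (F G H : K) :
    interp br (α + (y - z)) x w y (interp br α x y z F G) (interp br α w y z H G) =
      interp br α x w z F H := by
  have e1 : α + (y - z) + (w - y) = α + (w - z) := by abel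
  have e2 : α + (y - z) + (x - y) = α + (x - z) := by abel
  simp only [interp, e1, e2]
  -- The contributions of `G` cancel, being the same product of brackets in both inner
  -- interpolations; the Riemann relation is not needed.
  field_simp
  ring

/-- Composition of interpolations along the exchange of two of the last points. -/
theorem interp_interp_right {br : V → K}
    (hR : ∀ α x y z u, br (α + (x - u) + (y - z)) * br (x - y) * br α * br (z - u) =
      br (α + (x - u)) * br (x - z) * br (α + (y - z)) * br (y - u)
        - br (α + (x - z)) * br (x - u) * br (α + (y - u)) * br (y - z))
    {α x y z u : V} (hα : br α ≠ 0) (h1 : br (α + (y - z)) ≠ 0)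
    (h2 : br (x - y) ≠ 0) (h3 : br (x - z) ≠ 0) (F G : K) :
    interp br (α + (y - z)) x z u (interp br α x y z F G) G = interp br α x y u F G := by
  have e1 : α + (y - z) + (z - u) = α + (y - u) := by abel
  have e2 : α + (y - z) + (x - u) = α + (x - u) + (y - z) := by abel
  simp only [interp, e1, e2]
  -- The coefficients of `F` on the two sides already agree; equality of those of `G` is the Riemann
  -- relation.
  have h4 := hR α x y z u
  field_simp
  linear_combination (-G) * h4

end Interpolation

/-! ## The relations of the simple reflections on the `f` and `τ` variables -/

/-- The second term carries the factor [y - y] = 0: the interpolating function takes the value F at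
the node y. -/
theorem interp_self {V K : Type*} [AddCommGroup V] [Field K] {br : V → K} (h0 : br 0 = 0)
    {α x y : V} (hα : br α ≠ 0) (hxy : br (x - y) ≠ 0) (F G : K) :
    interp br α x y y F G = F := by
  simp only [interp, sub_self, add_zero, h0]
  field_simp
  ring

/-- The node `0`. -/
def zeroNode {m n : ℕ} (hmn : m < n) : Fin n := ⟨0, by omega⟩

/-- The node `m`, which is also the index number `m + 1`. -/
def branchNode {m n : ℕ} (hmn : m < n) : Fin n := ⟨m, hmn⟩

/-- The last of the first `m` indices. -/
def lastIndex {m : ℕ} (hm : 0 < m) : Fin m := ⟨m - 1, by omega⟩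

section Indices

variable {m n : ℕ} (hmn : m < n) (hm : 0 < m)

theorem point_val (i : Fin m) : (point hmn i : ℕ) = i := rfl

theorem lastIndex_val : (lastIndex hm : ℕ) = m - 1 := rfl

theorem branchNode_val : (branchNode hmn : ℕ) = m := rfl

theorem zeroNode_val : (zeroNode hmn : ℕ) = 0 := rfl

theorem point_injective : Function.Injective (point hmn) := Fin.castLE_injective hmn.le

theorem point_adjSwap {k : Fin n} (hk : (k : ℕ) < m) (i : Fin m) :
    point hmn (adjSwap ⟨k, hk⟩ i) = adjSwap k (point hmn i) := by
  apply Fin.ext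
  rw [point_val, adjSwap_val, adjSwap_val, point_val]

theorem adjSwap_branch_last : adjSwap (branchNode hmn) (point hmn (lastIndex hm)) = branchNode hmn := by
  apply Fin.ext
  simp [adjSwap_val, point_val, lastIndex_val, branchNode_val]

theorem adjSwap_self {N : ℕ} (k l : Fin N) (hl : (l : ℕ) + 1 = k) : adjSwap k k = l := by
  apply Fin.ext
  rw [adjSwap_val]
  split_ifs <;> omega

theorem adjSwap_branch_branch :
    adjSwap (branchNode hmn) (branchNode hmn) = point hmn (lastIndex hm) :=
  adjSwap_self _ _ (by rw [point_val, lastIndex_val, branchNode_val]; omega)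

theorem adjSwap_of_ne {N : ℕ} {k j : Fin N} (h1 : (j : ℕ) ≠ k - 1) (h2 : (j : ℕ) ≠ k) :
    adjSwap k j = j := by
  apply Fin.ext
  rw [adjSwap_val, if_neg h1, if_neg h2]

theorem ne_lastIndex {i : Fin m} (hi : i ≠ lastIndex hm) : (i : ℕ) ≠ m - 1 :=
  fun h0 => hi (Fin.ext h0)

theorem adjSwap_branch_point {i : Fin m} (hi : i ≠ lastIndex hm) :
    adjSwap (branchNode hmn) (point hmn i) = point hmn i :=
  adjSwap_of_ne (by rw [point_val, branchNode_val]; exact ne_lastIndex hm hi)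
    (by rw [point_val, branchNode_val]; omega)

end Indices

/-- A field with a function `[α]` subject to the Riemann relation and with nonzero elements `f_i`
and `τ_j`. -/
structure CremonaData {m n : ℕ} (hmn : m < n) (K : Type*) [Field K] where
  br : Module.Dual ℂ (Cartan n) → K
  f : Fin m → K
  τ : Fin n → K
  br_zero : br 0 = 0
  br_neg : ∀ α, br (-α) = -br α
  br_ne_zero : ∀ α, α ≠ 0 → br α ≠ 0
  br_riemann : ∀ α x y z u, br (α + (x - u) + (y - z)) * br (x - y) * br α * br (z - u) =
      br (α + (x - u)) * br (x - z) * br (α + (y - z)) * br (y - u)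
        - br (α + (x - z)) * br (x - u) * br (α + (y - u)) * br (y - z)
  f_ne_zero : ∀ i, f i ≠ 0
  τ_ne_zero : ∀ j, τ j ≠ 0

namespace CremonaData

variable {m n : ℕ} {hmn : m < n} (hm : 0 < m) {K : Type*} [Field K] (D : CremonaData hmn K)

/-- The quotient of `τ` variables in the action of `s_m` on the `f` variables. -/
def ratio : K := D.τ (point hmn (lastIndex hm)) / D.τ (branchNode hmn)

/-- The interpolation of `f_i` and `f_m` at the point `j`. -/
def interpAt (j : Fin n) (i : Fin m) : K :=
  interp D.br (simpleRoot m (zeroNode hmn)) (ε m (point hmn i).succ)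
    (ε m (point hmn (lastIndex hm)).succ) (ε m j.succ) (D.f i) (D.f (lastIndex hm))

/-- The prescribed image of `f_i` under `s_k`. -/
def fImage (k : Fin n) (i : Fin m) : K :=
  if (k : ℕ) = 0 then (D.f i)⁻¹
  else if hk : (k : ℕ) < m then D.f (adjSwap ⟨k, hk⟩ i)
  else if (k : ℕ) = m then
    D.ratio hm * if i = lastIndex hm then D.f i else D.interpAt hm (branchNode hmn) i
  else D.f i

/-- The prescribed image of `τ_j` under `s_k`. -/
def τImage (k : Fin n) (j : Fin n) : K :=
  if (k : ℕ) = 0 then (if hj : (j : ℕ) < m then D.τ j * D.f ⟨j, hj⟩ else D.τ j)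
  else D.τ (adjSwap k j)

/-- An endomorphism which acts on `[α]`, `f_i`, `τ_j` as prescribed for `s_k`. -/
structure IsRefl (k : Fin n) (φ : K →+* K) : Prop where
  br : ∀ α, φ (D.br α) = D.br (weylDual hmn (s m k) α)
  f : ∀ i, φ (D.f i) = D.fImage hm k i
  τ : ∀ j, φ (D.τ j) = D.τImage k j

variable {D hm}

theorem τImage_zero_point {k : Fin n} (hk : (k : ℕ) = 0) (i : Fin m) :
    D.τImage k (point hmn i) = D.τ (point hmn i) * D.f i := by
  rw [τImage, if_pos hk, dif_pos (show ((point hmn i : Fin n) : ℕ) < m from i.2)]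
  rfl

theorem τImage_zero_ge {k : Fin n} (hk : (k : ℕ) = 0) {j : Fin n} (hj : m ≤ (j : ℕ)) :
    D.τImage k j = D.τ j := by
  rw [τImage, if_pos hk, dif_neg (by omega)]

theorem τImage_pos {k : Fin n} (hk : (k : ℕ) ≠ 0) (j : Fin n) :
    D.τImage k j = D.τ (adjSwap k j) := by
  rw [τImage, if_neg hk]

theorem fImage_zero {k : Fin n} (hk : (k : ℕ) = 0) (i : Fin m) :
    D.fImage hm k i = (D.f i)⁻¹ := by
  rw [fImage, if_pos hk]

theorem fImage_lt {k : Fin n} (hk : (k : ℕ) ≠ 0) (hkm : (k : ℕ) < m) (i : Fin m) :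
    D.fImage hm k i = D.f (adjSwap ⟨k, hkm⟩ i) := by
  rw [fImage, if_neg hk, dif_pos hkm]

theorem fImage_gt {k : Fin n} (hk : m < (k : ℕ)) (i : Fin m) :
    D.fImage hm k i = D.f i := by
  rw [fImage, if_neg (by omega), dif_neg (by omega), if_neg (by omega)]

theorem fImage_branch_last :
    D.fImage hm (branchNode hmn) (lastIndex hm) = D.ratio hm * D.f (lastIndex hm) := by
  rw [fImage, if_neg (by rw [branchNode_val]; omega), dif_neg (by rw [branchNode_val]; omega),
    if_pos (branchNode_val hmn),
    if_pos rfl]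

theorem fImage_branch {i : Fin m} (hi : i ≠ lastIndex hm) :
    D.fImage hm (branchNode hmn) i = D.ratio hm * D.interpAt hm (branchNode hmn) i := by
  rw [fImage, if_neg (by rw [branchNode_val]; omega), dif_neg (by rw [branchNode_val]; omega),
    if_pos (branchNode_val hmn),
    if_neg hi]

theorem ratio_ne_zero : D.ratio hm ≠ 0 := div_ne_zero (D.τ_ne_zero _) (D.τ_ne_zero _)

theorem br_root_ne_zero : D.br (simpleRoot m (zeroNode hmn)) ≠ 0 :=
  D.br_ne_zero _ (simpleRoot_zero_ne_zero hmn _)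

theorem br_sub_ne_zero {i j : Fin n} (hij : i ≠ j) : D.br (ε m i.succ - ε m j.succ) ≠ 0 :=
  D.br_ne_zero _ (ε_sub_ne_zero hij)

theorem br_point_sub_ne_zero {i j : Fin m} (hij : i ≠ j) :
    D.br (ε m (point hmn i).succ - ε m (point hmn j).succ) ≠ 0 :=
  br_sub_ne_zero fun h0 => hij (point_injective hmn h0)

-- The argument of this bracket is the image of α_0 under s_m, hence nonzero because α_0 is.
variable (hm D) in
theorem br_shift_ne_zero : D.br (simpleRoot m (zeroNode hmn) +
    (ε m (point hmn (lastIndex hm)).succ - ε m (branchNode hmn).succ)) ≠ 0 := by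
  refine D.br_ne_zero _ fun h0 => simpleRoot_zero_ne_zero hmn (zeroNode hmn) ?_
  rw [← weylDual_simpleRoot_zero_m hmn _ _ _ rfl rfl
    (show ((point hmn (lastIndex hm) : Fin n) : ℕ) + 1 = m by
      rw [point_val, lastIndex_val]; omega)] at h0
  exact weylDual_injective hmn _ (h0.trans (map_zero _).symm)

theorem point_ne_branch (i : Fin m) : point hmn i ≠ branchNode hmn := fun h0 => by
  have := congrArg Fin.val h0
  rw [point_val, branchNode_val] at this
  omega

namespace IsRefl

variable {k l : Fin n} {φ ψ : K →+* K}

theorem map_interp (hφ : D.IsRefl hm k φ) (α x y z : Module.Dual ℂ (Cartan n)) (F G : K) :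
    φ (interp D.br α x y z F G) =
      interp D.br (weylDual hmn (s m k) α) (weylDual hmn (s m k) x) (weylDual hmn (s m k) y)
        (weylDual hmn (s m k) z) (φ F) (φ G) :=
  EllipticCremona.map_interp (d := (weylDual hmn (s m k)).toAddMonoidHom) hφ.br α x y z F G

/-- For `k ≥ 1`, `k ≠ m`, the reflection `s_k` permutes the interpolated values. -/
theorem map_interpAt (hφ : D.IsRefl hm k φ) (hk : (k : ℕ) ≠ 0) (hkm : (k : ℕ) ≠ m)
    (j : Fin n) (i : Fin m) :
    φ (D.interpAt hm j i) = interp D.br (simpleRoot m (zeroNode hmn))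
      (ε m (adjSwap k (point hmn i)).succ) (ε m (adjSwap k (point hmn (lastIndex hm))).succ)
      (ε m (adjSwap k j).succ) (D.fImage hm k i) (D.fImage hm k (lastIndex hm)) := by
  rw [interpAt, hφ.map_interp, weylDual_simpleRoot_zero_of_ne hmn _ k rfl hk hkm,
    weylDual_ε_pos hmn k hk, weylDual_ε_pos hmn k hk, weylDual_ε_pos hmn k hk, hφ.f, hφ.f]

theorem weylDual_branch_root : weylDual hmn (s m (branchNode hmn)) (simpleRoot m (zeroNode hmn)) =
    simpleRoot m (zeroNode hmn) +
      (ε m (point hmn (lastIndex hm)).succ - ε m (branchNode hmn).succ) :=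
  weylDual_simpleRoot_zero_m hmn _ _ _ rfl rfl (by rw [point_val, lastIndex_val]; omega)

theorem map_ratio_branch (hφ : D.IsRefl hm (branchNode hmn) φ) :
    φ (D.ratio hm) = (D.ratio hm)⁻¹ := by
  have h0 : ((branchNode hmn : Fin n) : ℕ) ≠ 0 := by rw [branchNode_val]; omega
  rw [ratio, map_div₀, hφ.τ, hφ.τ, τImage_pos h0, τImage_pos h0, adjSwap_branch_last,
    adjSwap_branch_branch hmn hm, inv_div]

/-- The reflection `s_m` sends the interpolated value at a point `j ≥ m + 2` to itself, up to a
factor. -/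
theorem map_interpAt_branch (hφ : D.IsRefl hm (branchNode hmn) φ) {j : Fin n} (hj : m < (j : ℕ))
    {i : Fin m} (hi : i ≠ lastIndex hm) :
    φ (D.interpAt hm j i) = D.ratio hm * D.interpAt hm j i := by
  have h0 : ((branchNode hmn : Fin n) : ℕ) ≠ 0 := by rw [branchNode_val]; omega
  have hj' : adjSwap (branchNode hmn) j = j :=
    adjSwap_of_ne (by rw [branchNode_val]; omega) (by rw [branchNode_val]; omega)
  rw [interpAt, hφ.map_interp, weylDual_branch_root (hm := hm),
    weylDual_ε_pos hmn _ h0, weylDual_ε_pos hmn _ h0, weylDual_ε_pos hmn _ h0, hφ.f, hφ.f,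
    adjSwap_branch_last, adjSwap_branch_point hmn hm hi, hj', fImage_branch_last,
    fImage_branch hi, interp_mul, interpAt, interp_interp_right D.br_riemann br_root_ne_zero
      (D.br_shift_ne_zero hm) (br_point_sub_ne_zero hi) (br_sub_ne_zero (point_ne_branch i))]

/-- Since s_m exchanges ε_m and ε_{m+1}, it resamples the interpolating function at the old node,
where the value is f_i. This is the reason for s_m² = 1 on the f variables. -/
theorem map_interpAt_branch_self (hφ : D.IsRefl hm (branchNode hmn) φ)
    {i : Fin m} (hi : i ≠ lastIndex hm) :
    φ (D.interpAt hm (branchNode hmn) i) = D.ratio hm * D.f i := by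
  have h0 : ((branchNode hmn : Fin n) : ℕ) ≠ 0 := by rw [branchNode_val]; omega
  rw [interpAt, hφ.map_interp, weylDual_branch_root (hm := hm),
    weylDual_ε_pos hmn _ h0, weylDual_ε_pos hmn _ h0, weylDual_ε_pos hmn _ h0, hφ.f, hφ.f,
    adjSwap_branch_last, adjSwap_branch_point hmn hm hi, adjSwap_branch_branch hmn hm,
    fImage_branch_last, fImage_branch hi, interp_mul, interpAt,
    interp_interp_right D.br_riemann br_root_ne_zero
      (D.br_shift_ne_zero hm) (br_point_sub_ne_zero hi) (br_sub_ne_zero (point_ne_branch i)),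
    interp_self D.br_zero br_root_ne_zero (br_point_sub_ne_zero hi)]

theorem sq_f (hφ : D.IsRefl hm k φ) (i : Fin m) : φ (φ (D.f i)) = D.f i := by
  rw [hφ.f]
  by_cases hk : (k : ℕ) = 0
  · rw [fImage_zero hk, map_inv₀, hφ.f, fImage_zero hk, inv_inv]
  rcases lt_trichotomy (k : ℕ) m with hkm | hkm | hkm
  · rw [fImage_lt hk hkm, hφ.f, fImage_lt hk hkm, adjSwap_adjSwap]
  · obtain rfl : k = branchNode hmn := Fin.ext hkm
    by_cases hi : i = lastIndex hm
    · subst hi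
      rw [fImage_branch_last, map_mul, hφ.map_ratio_branch, hφ.f, fImage_branch_last,
        inv_mul_cancel_left₀ ratio_ne_zero]
    · rw [fImage_branch hi, map_mul, hφ.map_ratio_branch, hφ.map_interpAt_branch_self hi,
        inv_mul_cancel_left₀ ratio_ne_zero]
  · rw [fImage_gt hkm, hφ.f, fImage_gt hkm]

theorem sq_τ (hφ : D.IsRefl hm k φ) (j : Fin n) : φ (φ (D.τ j)) = D.τ j := by
  rw [hφ.τ]
  by_cases hk : (k : ℕ) = 0
  · by_cases hj : (j : ℕ) < m
    · obtain ⟨i, rfl⟩ : ∃ i : Fin m, j = point hmn i := ⟨⟨j, hj⟩, rfl⟩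
      rw [τImage_zero_point hk, map_mul, hφ.τ, hφ.f, τImage_zero_point hk, fImage_zero hk,
        mul_inv_cancel_right₀ (D.f_ne_zero i)]
    · rw [τImage_zero_ge hk (by omega), hφ.τ, τImage_zero_ge hk (by omega)]
  · rw [τImage_pos hk, hφ.τ, τImage_pos hk, adjSwap_adjSwap]

theorem map_ratio_of_pos (hφ : D.IsRefl hm k φ) (hk : (k : ℕ) ≠ 0) : φ (D.ratio hm) =
    D.τ (adjSwap k (point hmn (lastIndex hm))) / D.τ (adjSwap k (branchNode hmn)) := by
  rw [ratio, map_div₀, hφ.τ, hφ.τ, τImage_pos hk, τImage_pos hk]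

/-- The only case with content is that one of the two nodes is m. The other reflection then permutes
the points in the interpolation formula and keeps the points number m and m+1 fixed, so the formula
is equivariant. -/
theorem comm_f (hφ : D.IsRefl hm k φ) (hψ : D.IsRefl hm l ψ) (hkl : (k : ℕ) < l)
    (h0 : (k : ℕ) = 0 → (l : ℕ) ≠ m) (h1 : (k : ℕ) ≠ 0 → (k : ℕ) + 1 ≠ l) (i : Fin m) :
    φ (ψ (D.f i)) = ψ (φ (D.f i)) := by
  have hl : (l : ℕ) ≠ 0 := by omega
  rw [hφ.f, hψ.f]
  rcases lt_trichotomy (l : ℕ) m with hlm | hlm | hlm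
  · rw [fImage_lt hl hlm, hφ.f]
    by_cases hk : (k : ℕ) = 0
    · rw [fImage_zero hk, fImage_zero hk, map_inv₀, hψ.f, fImage_lt hl hlm]
    · have hkm : (k : ℕ) < m := by omega
      have h2 := h1 hk
      rw [fImage_lt hk hkm, fImage_lt hk hkm, hψ.f, fImage_lt hl hlm, adjSwap_comm]
      simp only
      omega
  · have hk : (k : ℕ) ≠ 0 := fun h => h0 h hlm
    have hkm : (k : ℕ) < m := by omega
    have h2 := h1 hk
    obtain rfl : l = branchNode hmn := Fin.ext hlm
    rw [branchNode_val] at h2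
    have h3 : adjSwap k (branchNode hmn) = branchNode hmn :=
      adjSwap_of_ne (by rw [branchNode_val]; omega) (by rw [branchNode_val]; omega)
    have h4 : adjSwap ⟨k, hkm⟩ (lastIndex hm) = lastIndex hm :=
      adjSwap_of_ne (by rw [lastIndex_val]; simp only; omega)
        (by rw [lastIndex_val]; simp only; omega)
    have h5 : adjSwap k (point hmn (lastIndex hm)) = point hmn (lastIndex hm) := by
      rw [← point_adjSwap hmn hkm, h4]
    have h6 : φ (D.ratio hm) = D.ratio hm := by rw [hφ.map_ratio_of_pos hk, h3, h5, ratio]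
    by_cases hi : i = lastIndex hm
    · subst hi
      rw [fImage_branch_last, fImage_lt hk hkm, h4, map_mul, h6, hφ.f, hψ.f, fImage_lt hk hkm, h4,
        fImage_branch_last]
    · have hi' : adjSwap ⟨k, hkm⟩ i ≠ lastIndex hm := fun h7 =>
        hi ((adjSwap _).injective (h7.trans h4.symm))
      rw [fImage_branch hi, fImage_lt hk hkm, hψ.f, fImage_branch hi', map_mul, h6,
        hφ.map_interpAt hk (by omega), h3, h5, fImage_lt hk hkm, fImage_lt hk hkm, h4, interpAt,
        point_adjSwap hmn hkm]
  · rw [fImage_gt hlm, hφ.f]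
    by_cases hk : (k : ℕ) = 0
    · rw [fImage_zero hk, map_inv₀, hψ.f, fImage_gt hlm]
    have h2 := h1 hk
    rcases lt_trichotomy (k : ℕ) m with hkm | hkm | hkm
    · rw [fImage_lt hk hkm, hψ.f, fImage_gt hlm]
    · obtain rfl : k = branchNode hmn := Fin.ext hkm
      rw [branchNode_val] at h2
      have h3 : adjSwap l (branchNode hmn) = branchNode hmn :=
        adjSwap_of_ne (by rw [branchNode_val]; omega) (by rw [branchNode_val]; omega)
      have h5 : ∀ i, adjSwap l (point hmn i) = point hmn i := fun i =>
        adjSwap_of_ne (by rw [point_val]; omega) (by rw [point_val]; omega)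
      have h6 : ψ (D.ratio hm) = D.ratio hm := by rw [hψ.map_ratio_of_pos hl, h3, h5, ratio]
      by_cases hi : i = lastIndex hm
      · subst hi
        rw [fImage_branch_last, map_mul, h6, hψ.f, fImage_gt hlm]
      · rw [fImage_branch hi, map_mul, h6, hψ.map_interpAt hl (by omega), h3, h5, h5,
          fImage_gt hlm, fImage_gt hlm, interpAt]
    · rw [fImage_gt hkm, hψ.f, fImage_gt hlm]

theorem comm_τ (hφ : D.IsRefl hm k φ) (hψ : D.IsRefl hm l ψ) (hkl : (k : ℕ) < l)
    (h0 : (k : ℕ) = 0 → (l : ℕ) ≠ m) (h1 : (k : ℕ) ≠ 0 → (k : ℕ) + 1 ≠ l) (j : Fin n) :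
    φ (ψ (D.τ j)) = ψ (φ (D.τ j)) := by
  have hl : (l : ℕ) ≠ 0 := by omega
  rw [hφ.τ, hψ.τ, τImage_pos hl, hφ.τ]
  by_cases hk : (k : ℕ) = 0
  · have hlm := h0 hk
    by_cases hj : (j : ℕ) < m
    · obtain ⟨i, rfl⟩ : ∃ i : Fin m, j = point hmn i := ⟨⟨j, hj⟩, rfl⟩
      rw [τImage_zero_point hk, map_mul, hψ.τ, hψ.f, τImage_pos hl]
      rcases lt_or_gt_of_ne hlm with hlm | hlm
      · rw [fImage_lt hl hlm, ← point_adjSwap hmn hlm, τImage_zero_point hk]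
      · have h3 : adjSwap l (point hmn i) = point hmn i :=
          adjSwap_of_ne (by rw [point_val]; omega) (by rw [point_val]; omega)
        rw [h3, fImage_gt hlm, τImage_zero_point hk]
    · rw [τImage_zero_ge hk (j := j) (by omega), hψ.τ, τImage_pos hl, τImage_zero_ge hk]
      rw [adjSwap_val]
      split_ifs <;> omega
  · have h2 := h1 hk
    rw [τImage_pos hk, τImage_pos hk, hψ.τ, τImage_pos hl, adjSwap_comm (by omega)]

/-- Inverting the values divides the interpolation by f_i f_m (`interp_inv`), and the quotient of τ
variables acquires a factor f_m, so only the division by f_i survives. Together with the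
involutivity of the two reflections this identity gives their braid relation. -/
theorem zero_branch_f (hφ : D.IsRefl hm (zeroNode hmn) φ) (hψ : D.IsRefl hm (branchNode hmn) ψ)
    (i : Fin m) : φ (ψ (D.f i)) = ψ (D.f i) / D.f i := by
  have h0 : ((zeroNode hmn : Fin n) : ℕ) = 0 := rfl
  have hT : φ (D.ratio hm) = D.ratio hm * D.f (lastIndex hm) := by
    rw [ratio, map_div₀, hφ.τ, hφ.τ, τImage_zero_point h0,
      τImage_zero_ge h0 (by rw [branchNode_val]), mul_div_right_comm]
  rw [hψ.f]
  by_cases hi : i = lastIndex hm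
  · subst hi
    rw [fImage_branch_last, map_mul, hT, hφ.f, fImage_zero h0, div_eq_mul_inv]
  · have h1 := D.f_ne_zero i
    have h2 := D.f_ne_zero (lastIndex hm)
    rw [fImage_branch hi, map_mul, hT, interpAt, hφ.map_interp,
      weylDual_simpleRoot_self, weylDual_zero_ε_lt hmn _ h0 _ i.2,
      weylDual_zero_ε_lt hmn _ h0 _ (lastIndex hm).2,
      weylDual_zero_ε_ge hmn _ h0 _ (by rw [branchNode_val]), hφ.f, hφ.f, fImage_zero h0,
      fImage_zero h0, interp_inv D.br_neg h1 h2]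
    field_simp

theorem zero_braid_f (hφ : D.IsRefl hm (zeroNode hmn) φ) (hψ : D.IsRefl hm (branchNode hmn) ψ)
    (i : Fin m) : φ (ψ (φ (D.f i))) = ψ (φ (ψ (D.f i))) := by
  -- Both sides become f_i / s_m(f_i).
  rw [hφ.zero_branch_f hψ, map_div₀, hψ.sq_f, hφ.f i, fImage_zero rfl, map_inv₀, map_inv₀,
    hφ.zero_branch_f hψ, inv_div]

theorem zero_braid_τ (hφ : D.IsRefl hm (zeroNode hmn) φ) (hψ : D.IsRefl hm (branchNode hmn) ψ)
    (j : Fin n) : φ (ψ (φ (D.τ j))) = ψ (φ (ψ (D.τ j))) := by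
  have h0 : ((zeroNode hmn : Fin n) : ℕ) = 0 := rfl
  have hb : ((branchNode hmn : Fin n) : ℕ) ≠ 0 := by rw [branchNode_val]; omega
  have ha := D.τ_ne_zero (point hmn (lastIndex hm))
  have hc := D.τ_ne_zero (branchNode hmn)
  have hf := D.f_ne_zero (lastIndex hm)
  have e1 : φ (D.τ (branchNode hmn)) = D.τ (branchNode hmn) := by
    rw [hφ.τ, τImage_zero_ge h0 (by rw [branchNode_val])]
  have e2 : ψ (D.τ (branchNode hmn)) = D.τ (point hmn (lastIndex hm)) := by
    rw [hψ.τ, τImage_pos hb, adjSwap_branch_branch hmn hm]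
  have e3 : ψ (D.τ (point hmn (lastIndex hm))) = D.τ (branchNode hmn) := by
    rw [hψ.τ, τImage_pos hb, adjSwap_branch_last]
  have e4 : ∀ i, φ (D.τ (point hmn i)) = D.τ (point hmn i) * D.f i := fun i => by
    rw [hφ.τ, τImage_zero_point h0]
  have e5 : ψ (D.f (lastIndex hm)) = D.ratio hm * D.f (lastIndex hm) := by
    rw [hψ.f, fImage_branch_last]
  have e6 : D.τ (branchNode hmn) * (D.ratio hm * D.f (lastIndex hm)) =
      D.τ (point hmn (lastIndex hm)) * D.f (lastIndex hm) := by
    rw [ratio]; field_simp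
  by_cases hj : (j : ℕ) < m
  · obtain ⟨i, rfl⟩ : ∃ i : Fin m, j = point hmn i := ⟨⟨j, hj⟩, rfl⟩
    by_cases hi : i = lastIndex hm
    · subst hi
      rw [e3, e1, e2, e4, map_mul, e3, e5, e6, map_mul, e4, hφ.f, fImage_zero h0,
        mul_inv_cancel_right₀ hf]
    · have e7 : ψ (D.τ (point hmn i)) = D.τ (point hmn i) := by
        rw [hψ.τ, τImage_pos hb, adjSwap_branch_point hmn hm hi]
      -- Both sides equal τ_i s_m(f_i): the factor f_i produced by s_0 cancels the division by f_i
      -- in `zero_branch_f`.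
      rw [e7, e4, map_mul, map_mul, e7, e4, hφ.zero_branch_f hψ, mul_assoc,
        mul_div_cancel₀ _ (D.f_ne_zero i)]
  · by_cases hjm : (j : ℕ) = m
    · obtain rfl : j = branchNode hmn := Fin.ext hjm
      rw [e1, e2, e4, map_mul, e3, e5, e6]
    · have e8 : φ (D.τ j) = D.τ j := by rw [hφ.τ, τImage_zero_ge h0 (by omega)]
      have e9 : ψ (D.τ j) = D.τ j := by
        rw [hψ.τ, τImage_pos hb, adjSwap_of_ne (by rw [branchNode_val]; omega)
          (by rw [branchNode_val]; omega)]
      rw [e8, e9, e8, e9]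

theorem braid_τ (hφ : D.IsRefl hm k φ) (hψ : D.IsRefl hm l ψ) (hk : (k : ℕ) ≠ 0)
    (hkl : (l : ℕ) = k + 1) (j : Fin n) : φ (ψ (φ (D.τ j))) = ψ (φ (ψ (D.τ j))) := by
  have hl : (l : ℕ) ≠ 0 := by omega
  have e1 : ∀ j, φ (D.τ j) = D.τ (adjSwap k j) := fun j => by rw [hφ.τ, τImage_pos hk]
  have e2 : ∀ j, ψ (D.τ j) = D.τ (adjSwap l j) := fun j => by rw [hψ.τ, τImage_pos hl]
  rw [e1, e2, e1, e2, e1, e2, adjSwap_braid hk hkl]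

/-- The braid relation of `s_{m-1}` and `s_m` on the `f` variables. -/
theorem braid_f_left (hφ : D.IsRefl hm k φ) (hψ : D.IsRefl hm (branchNode hmn) ψ)
    (hk : (k : ℕ) ≠ 0) (hkl : m = k + 1) (i : Fin m) :
    φ (ψ (φ (D.f i))) = ψ (φ (ψ (D.f i))) := by
  have hb : ((branchNode hmn : Fin n) : ℕ) ≠ 0 := by rw [branchNode_val]; omega
  have hkm : (k : ℕ) < m := by omega
  obtain ⟨p, hp⟩ : ∃ p : Fin m, p = ⟨(k : ℕ) - 1, by omega⟩ := ⟨_, rfl⟩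
  have hpv : (p : ℕ) = k - 1 := by rw [hp]
  have hka : (⟨k, hkm⟩ : Fin m) = lastIndex hm := Fin.ext (by rw [lastIndex_val]; simp only; omega)
  have hpa : p ≠ lastIndex hm := fun h0 => by
    have := congrArg Fin.val h0
    rw [lastIndex_val] at this
    omega
  have s1 : adjSwap ⟨k, hkm⟩ p = lastIndex hm := by
    rw [← hka]; exact Fin.ext (by rw [adjSwap_val, if_pos hpv])
  have s2 : adjSwap ⟨k, hkm⟩ (lastIndex hm) = p := by
    rw [← s1, adjSwap_adjSwap]
  have s3 : ∀ i, i ≠ p → i ≠ lastIndex hm → adjSwap ⟨k, hkm⟩ i = i := fun i h1 h2 =>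
    adjSwap_of_ne (fun h3 => h1 (Fin.ext (h3.trans hpv.symm)))
      (fun h3 => h2 (by rw [← hka]; exact Fin.ext h3))
  have sc : adjSwap k (branchNode hmn) = branchNode hmn :=
    adjSwap_of_ne (by rw [branchNode_val]; omega) (by rw [branchNode_val]; omega)
  have t1 := D.τ_ne_zero (point hmn p)
  have t2 := D.τ_ne_zero (point hmn (lastIndex hm))
  have t3 := D.τ_ne_zero (branchNode hmn)
  have hf : ∀ i, φ (D.f i) = D.f (adjSwap ⟨k, hkm⟩ i) := fun i => by rw [hφ.f, fImage_lt hk hkm]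
  have hR : φ (D.ratio hm) = D.τ (point hmn p) / D.τ (branchNode hmn) := by
    rw [hφ.map_ratio_of_pos hk, sc, ← point_adjSwap hmn hkm, s2]
  -- The τ quotients compose as (τ_{m-1}/τ_m)(τ_m/τ_{m+1}) = τ_{m-1}/τ_{m+1}. This takes care of the
  -- scalar factors, and only interpolations remain to be compared.
  have hR' : ψ (D.τ (point hmn p) / D.τ (branchNode hmn)) * D.ratio hm =
      D.τ (point hmn p) / D.τ (branchNode hmn) := by
    rw [map_div₀, hψ.τ, hψ.τ, τImage_pos hb, τImage_pos hb, adjSwap_branch_point hmn hm hpa,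
      adjSwap_branch_branch hmn hm, ratio]
    field_simp
  have hpI : φ (ψ (D.f p)) =
      D.τ (point hmn p) / D.τ (branchNode hmn) * D.interpAt hm (branchNode hmn) p := by
    rw [hψ.f, fImage_branch hpa, map_mul, hR, hφ.map_interpAt hk (by omega), sc,
      ← point_adjSwap hmn hkm, ← point_adjSwap hmn hkm, fImage_lt hk hkm, fImage_lt hk hkm, s1, s2,
      interp_swap D.br_neg, interpAt]
  by_cases hi : i = lastIndex hm
  · subst hi
    rw [hf, s2, hpI, hψ.f, fImage_branch_last, map_mul, hf, s2, hR, map_mul, hψ.f,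
      fImage_branch hpa, ← mul_assoc, hR']
  · by_cases hip : i = p
    · subst hip
      rw [hpI, map_mul, hψ.map_interpAt_branch_self hpa, ← mul_assoc, hR', hf, s1, hψ.f,
        fImage_branch_last, map_mul, hf, s2, hR]
    · have hni : point hmn i ≠ point hmn p := fun h0 => hip (point_injective hmn h0)
      -- Here s_{m-1} fixes f_i, so it remains to see that s_m fixes the element computed here. That
      -- is the elimination of f_m in `interp_interp_left`.
      have e1 : φ (ψ (D.f i)) = D.τ (point hmn p) / D.τ (branchNode hmn) *
          interp D.br (simpleRoot m (zeroNode hmn)) (ε m (point hmn i).succ)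
            (ε m (point hmn p).succ) (ε m (branchNode hmn).succ) (D.f i) (D.f p) := by
        rw [hψ.f, fImage_branch hi, map_mul, hR, hφ.map_interpAt hk (by omega), sc,
          ← point_adjSwap hmn hkm, ← point_adjSwap hmn hkm, fImage_lt hk hkm, fImage_lt hk hkm,
          s3 i hip hi, s2]
      rw [hf, s3 i hip hi, e1, map_mul, hψ.map_interp, weylDual_branch_root (hm := hm),
        weylDual_ε_pos hmn _ hb, weylDual_ε_pos hmn _ hb, weylDual_ε_pos hmn _ hb,
        adjSwap_branch_point hmn hm hpa, adjSwap_branch_point hmn hm hi,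
        adjSwap_branch_branch hmn hm, hψ.f, hψ.f, fImage_branch hpa, fImage_branch hi,
        interp_mul, ← mul_assoc, hR', interpAt, interpAt,
        interp_interp_left br_root_ne_zero (D.br_shift_ne_zero hm) (br_point_sub_ne_zero hi)
          (br_point_sub_ne_zero hpa) (br_point_sub_ne_zero hip)]

/-- The braid relation of `s_m` and `s_{m+1}` on the `f` variables. -/
theorem braid_f_right (hφ : D.IsRefl hm (branchNode hmn) φ) (hψ : D.IsRefl hm l ψ)
    (hl : (l : ℕ) = m + 1) (i : Fin m) :
    φ (ψ (φ (D.f i))) = ψ (φ (ψ (D.f i))) := by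
  have hb : ((branchNode hmn : Fin n) : ℕ) ≠ 0 := by rw [branchNode_val]; omega
  have hl0 : (l : ℕ) ≠ 0 := by omega
  have hlm : m < (l : ℕ) := by omega
  have sc : adjSwap l (branchNode hmn) = l :=
    Fin.ext (by rw [adjSwap_val, branchNode_val, if_pos (by omega)])
  have sp : ∀ i, adjSwap l (point hmn i) = point hmn i := fun i =>
    adjSwap_of_ne (by rw [point_val]; omega) (by rw [point_val]; omega)
  have sl : adjSwap (branchNode hmn) l = l :=
    adjSwap_of_ne (by rw [branchNode_val]; omega) (by rw [branchNode_val]; omega)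
  have t1 := D.τ_ne_zero l
  have t2 := D.τ_ne_zero (point hmn (lastIndex hm))
  have t3 := D.τ_ne_zero (branchNode hmn)
  have hf : ∀ i, ψ (D.f i) = D.f i := fun i => by rw [hψ.f, fImage_gt hlm]
  have hR : ψ (D.ratio hm) = D.τ (point hmn (lastIndex hm)) / D.τ l := by
    rw [hψ.map_ratio_of_pos hl0, sc, sp]
  have hR' : φ (D.τ (point hmn (lastIndex hm)) / D.τ l) * D.ratio hm =
      D.τ (point hmn (lastIndex hm)) / D.τ l := by
    rw [map_div₀, hφ.τ, hφ.τ, τImage_pos hb, τImage_pos hb, adjSwap_branch_last, sl, ratio]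
    field_simp
  by_cases hi : i = lastIndex hm
  · subst hi
    rw [hf, hφ.f, fImage_branch_last, map_mul, hf, hR, map_mul, hφ.f, fImage_branch_last,
      ← mul_assoc, hR']
  -- This is the interpolating function evaluated at the point number m+2, up to a τ quotient. It is
  -- fixed by s_m through resampling, and s_{m+1} fixes f_i, so both sides of the braid relation
  -- equal it.
  · have e1 : ψ (φ (D.f i)) =
        D.τ (point hmn (lastIndex hm)) / D.τ l * D.interpAt hm l i := by
      rw [hφ.f, fImage_branch hi, map_mul, hR, hψ.map_interpAt hl0 (by omega), sc, sp, sp,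
        fImage_gt hlm, fImage_gt hlm, interpAt]
    rw [hf, e1, map_mul, hφ.map_interpAt_branch hlm hi, ← mul_assoc, hR']

theorem braid_f (hφ : D.IsRefl hm k φ) (hψ : D.IsRefl hm l ψ) (hk : (k : ℕ) ≠ 0)
    (hkl : (l : ℕ) = k + 1) (i : Fin m) : φ (ψ (φ (D.f i))) = ψ (φ (ψ (D.f i))) := by
  have hl : (l : ℕ) ≠ 0 := by omega
  rcases lt_trichotomy (l : ℕ) m with hlm | hlm | hlm
  · have hkm : (k : ℕ) < m := by omega
    have e1 : ∀ j, φ (D.f j) = D.f (adjSwap ⟨k, hkm⟩ j) := fun j => by rw [hφ.f, fImage_lt hk hkm]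
    have e2 : ∀ j, ψ (D.f j) = D.f (adjSwap ⟨l, hlm⟩ j) := fun j => by rw [hψ.f, fImage_lt hl hlm]
    rw [e1, e2, e1, e2, e1, e2, adjSwap_braid (by simpa using hk) (by simpa using hkl)]
  · obtain rfl : l = branchNode hmn := Fin.ext hlm
    exact braid_f_left hφ hψ hk hkl i
  · by_cases hkm : (k : ℕ) = m
    · obtain rfl : k = branchNode hmn := Fin.ext hkm
      exact braid_f_right hφ hψ hkl i
    · have hkm' : m < (k : ℕ) := by omega
      rw [hφ.f, hψ.f, fImage_gt hlm, fImage_gt hkm', hφ.f, hψ.f, fImage_gt hlm, fImage_gt hkm',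
        hφ.f, hψ.f, fImage_gt hlm, fImage_gt hkm']

end IsRefl

end CremonaData

/-! ## Permutations of the indices as elements of the Weyl group -/

section Permutations

variable {m n : ℕ}

theorem weylRep_s {R : Type} [CommRing R] (hmn : m < n) (k : Fin n) (x : LatticeOver R n) :
    weylRep R hmn (s m k) x = x - form R m n (h R m k) x • h R m k := by
  have h2 : weylRep R hmn (s m k) = reflection R m n k :=
    (coxeterMatrix m n).toCoxeterSystem.lift_apply_simple (reflection_isLiftable hmn) k
  rw [h2, reflection_apply]

theorem form_h_e_pos {R : Type} [CommRing R] (k : Fin n) (hk : (k : ℕ) ≠ 0) (i : Fin (n + 1)) :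
    form R m n (h R m k) (e R i) =
      (if (i : ℕ) = k then 1 else 0) - (if (i : ℕ) = k + 1 then 1 else 0) := by
  rw [form_h_pos k hk]
  simp [e, Pi.single_apply, Fin.ext_iff, eq_comm]

theorem weylRep_e_pos {R : Type} [CommRing R] (hmn : m < n) (k : Fin n) (hk : (k : ℕ) ≠ 0)
    (j : Fin n) : weylRep R hmn (s m k) (e R j.succ) = e R (adjSwap k j).succ := by
  rw [weylRep_s, form_h_e_pos k hk, h, if_neg hk, Fin.val_succ]
  have hv := adjSwap_val k j
  by_cases h1 : (j : ℕ) = k - 1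
  · rw [if_pos h1] at hv
    have h2 : adjSwap k j = k := Fin.ext hv
    have h3 : k.castSucc = j.succ := Fin.ext (by simp; omega)
    rw [if_pos (by omega), if_neg (by omega), h2, h3]
    module
  · by_cases h2 : (j : ℕ) = k
    · rw [if_neg h1, if_pos h2] at hv
      have h3 : k.castSucc = (adjSwap k j).succ := Fin.ext (by simp; omega)
      have h4 : j = k := Fin.ext h2
      rw [if_neg (by omega), if_pos (by omega), h3, h4]
      module
    · rw [if_neg h1, if_neg h2] at hv
      rw [if_neg (by omega), if_neg (by omega), Fin.ext hv]
      module

theorem weylRep_e_zero_pos {R : Type} [CommRing R] (hmn : m < n) (k : Fin n) (hk : (k : ℕ) ≠ 0) :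
    weylRep R hmn (s m k) (e R 0) = e R 0 := by
  rw [weylRep_s, form_h_e_pos k hk, if_neg (by simp; omega), if_neg (by simp)]
  module

theorem weylDual_ε_zero_pos (hmn : m < n) (k : Fin n) (hk : (k : ℕ) ≠ 0) :
    weylDual hmn (s m k) (ε m 0) = ε m 0 := by
  rw [weylDual_s, ε, form_comm, form_h_e_pos k hk, if_neg (by simp; omega), if_neg (by simp)]
  module

theorem algAction_mul {G R L : Type*} [Group G] [CommSemiring R] [Semiring L] [Algebra R L]
    (ρ : G →* (L ≃ₐ[R] L)) (u w : G) (x : L) : ρ (u * w) x = ρ u (ρ w x) := by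
  rw [map_mul, AlgEquiv.mul_apply]

/-- Every permutation of `e₁, …, eₙ` comes from an element of the Weyl group, which acts
accordingly on the `τ` variables. -/
theorem exists_weyl_perm (hmn : m < n) (π : Equiv.Perm (Fin n)) : ∃ w : Weyl m n,
    (∀ j : Fin n, weylDual hmn w (ε m j.succ) = ε m (π j).succ) ∧
    weylDual hmn w (ε m 0) = ε m 0 ∧
    (∀ j : Fin n, weylRep ℤ hmn w (e ℤ j.succ) = e ℤ (π j).succ) ∧
    weylRep ℤ hmn w (e ℤ 0) = e ℤ 0 ∧
    ∀ (b : Bracket) (ρ : Weyl m n →* (tauField b hmn ≃ₐ[ℂ] tauField b hmn)),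
      IsTauAction b hmn ρ → ∀ j, ρ w (τElt b hmn j) = τElt b hmn (π j) := by
  obtain ⟨N, rfl⟩ : ∃ N, n = N + 1 := ⟨n - 1, by omega⟩
  -- Adjacent transpositions generate the symmetric group even as a monoid, so the induction has no
  -- case of inverses.
  have hπ : π ∈ Submonoid.closure
      (Set.range fun i : Fin N => Equiv.swap i.castSucc i.succ) := by
    rw [Equiv.Perm.mclosure_swap_castSucc_succ]; trivial
  induction hπ using Submonoid.closure_induction with
  | mem π hπ =>
    obtain ⟨i, rfl⟩ := hπ
    have hk : ((i.succ : Fin (N + 1)) : ℕ) ≠ 0 := by simp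
    have h1 : Equiv.swap i.castSucc i.succ = adjSwap i.succ := rfl
    refine ⟨s m i.succ, fun j => ?_, weylDual_ε_zero_pos hmn _ hk, fun j => ?_,
      weylRep_e_zero_pos hmn _ hk, fun b ρ hρ j => ?_⟩
    · rw [weylDual_ε_pos hmn _ hk]; rfl
    · rw [weylRep_e_pos hmn _ hk]; rfl
    · rw [hρ.s_pos_τ _ hk]; rfl
  | one =>
    refine ⟨1, fun j => ?_, ?_, fun j => ?_, ?_, fun b ρ _ j => ?_⟩ <;> rw [map_one] <;> rfl
  | mul π π' _ _ ih ih' =>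
    obtain ⟨w, h1, h2, h3, h4, h5⟩ := ih
    obtain ⟨w', h1', h2', h3', h4', h5'⟩ := ih'
    refine ⟨w * w', fun j => ?_, ?_, fun j => ?_, ?_, fun b ρ hρ j => ?_⟩
    · rw [map_mul, Module.End.mul_apply, h1', h1]; rfl
    · rw [map_mul, Module.End.mul_apply, h2', h2]
    · rw [map_mul, Module.End.mul_apply, h3', h3]; rfl
    · rw [map_mul, Module.End.mul_apply, h4', h4]
    · exact (algAction_mul ρ w w' _).trans
        ((congrArg (ρ w) (h5' b ρ hρ j)).trans (h5 b ρ hρ (π' j)))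

theorem sum_point {M : Type*} [AddCommMonoid M] (hmn : m < n) (g : Fin n → M) :
    (∑ j : Fin n, if (j : ℕ) < m then g j else 0) = ∑ i : Fin m, g (point hmn i) := by
  symm
  refine Finset.sum_of_injOn (point hmn) ((point_injective hmn).injOn) (by simp)
    (fun j _ hj => if_neg fun h0 => hj ⟨⟨j, h0⟩, by simp, rfl⟩) fun i _ => ?_
  rw [if_pos (by rw [point_val]; exact i.2)]

theorem simpleRoot_zero (hmn : m < n) {z : Fin n} (hz : (z : ℕ) = 0) :
    simpleRoot m z = ε m 0 - ∑ i : Fin m, ε m (point hmn i).succ := by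
  rw [← sum_point hmn fun j => ε m j.succ, simpleRoot, h, if_pos hz, map_sub, map_sum]
  congr 1
  refine Finset.sum_congr rfl fun j _ => ?_
  rw [apply_ite (form ℂ m n), map_zero]
  rfl

/-- Permutations in W move the m indices occurring in α_0 to any m distinct indices. This lemma and
the next two put every bracket of the defining formulas into 𝕂. -/
theorem zero_sub_sum_mem_realRoots (hmn : m < n) {g : Fin m → Fin n} (hg : Function.Injective g) :
    ε m 0 - ∑ i, ε m (g i).succ ∈ realRoots hmn := by
  obtain ⟨π, hπ⟩ := Equiv.Perm.exists_extending_pair _ _ (point_injective hmn) hg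
  obtain ⟨w, h1, h2, -⟩ := exists_weyl_perm hmn π
  refine ⟨w, zeroNode hmn, ?_⟩
  rw [simpleRoot_zero hmn rfl, map_sub, map_sum, h2]
  simp only [h1, hπ]

/-- This is a permutation of α_1 = ε_1 - ε_2; the node 1 exists because 0 < m < n. -/
theorem ε_sub_mem_realRoots (hm : 0 < m) (hmn : m < n) {i j : Fin n} (hij : i ≠ j) :
    ε m i.succ - ε m j.succ ∈ realRoots hmn := by
  have hinj : Function.Injective ![(⟨0, by omega⟩ : Fin n), ⟨1, by omega⟩] := by
    intro a c; fin_cases a <;> fin_cases c <;> simp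
  have hinj' : Function.Injective ![i, j] := by
    intro a c; fin_cases a <;> fin_cases c <;> simp [hij, hij.symm]
  obtain ⟨π, hπ⟩ := Equiv.Perm.exists_extending_pair _ _ hinj hinj'
  obtain ⟨w, h1, -⟩ := exists_weyl_perm hmn π
  refine ⟨w, ⟨1, by omega⟩, ?_⟩
  rw [simpleRoot_pos _ (by simp), map_sub]
  have e0 := hπ 0
  have e1 := hπ 1
  simp only [Matrix.cons_val_zero, Matrix.cons_val_one] at e0 e1
  have h2 : (Fin.castSucc ⟨1, by omega⟩ : Fin (n + 1)) = (⟨0, by omega⟩ : Fin n).succ := rfl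
  rw [h2, h1, h1, e0, e1]

/-- Adding ε_i - ε_c to α_0 replaces the index i by c in the sum, and c is not among the first m
indices, so the indices stay distinct. -/
theorem root_add_mem_realRoots (hmn : m < n) {z : Fin n} (hz : (z : ℕ) = 0) (i : Fin m)
    {c : Fin n} (hc : m ≤ (c : ℕ)) :
    simpleRoot m z + (ε m (point hmn i).succ - ε m c.succ) ∈ realRoots hmn := by
  have hne : ∀ i, point hmn i ≠ c := fun i h0 => by
    have := congrArg Fin.val h0
    rw [point_val] at this
    omega
  have hg : Function.Injective (Function.update (point hmn) i c) := by
    intro a d had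
    by_cases h1 : a = i
    · by_cases h2 : d = i
      · rw [h1, h2]
      · rw [h1, Function.update_self, Function.update_of_ne h2] at had
        exact (hne d had.symm).elim
    · by_cases h2 : d = i
      · rw [h2, Function.update_self, Function.update_of_ne h1] at had
        exact (hne a had).elim
      · rw [Function.update_of_ne h1, Function.update_of_ne h2] at had
        exact point_injective hmn had
  convert zero_sub_sum_mem_realRoots hmn hg using 1
  have h1 : ∑ j ∈ Finset.univ.erase i, ε m (Function.update (point hmn) i c j).succ =
      ∑ j ∈ Finset.univ.erase i, ε m (point hmn j).succ :=
    Finset.sum_congr rfl fun j hj => by rw [Function.update_of_ne (Finset.ne_of_mem_erase hj)]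
  rw [simpleRoot_zero hmn hz, ← Finset.add_sum_erase _ _ (Finset.mem_univ i),
    ← Finset.add_sum_erase _ (fun j => ε m (Function.update (point hmn) i c j).succ)
      (Finset.mem_univ i), Function.update_self, h1]
  abel

theorem simpleRoot_mem_realRoots (hmn : m < n) (k : Fin n) : simpleRoot m k ∈ realRoots hmn :=
  ⟨1, k, by rw [map_one, Module.End.one_apply]⟩

end Permutations

/-! ## Construction of the action -/

namespace CremonaData

variable {m n : ℕ} {hmn : m < n} (hm : 0 < m) {K : Type*} [Field K] (D : CremonaData hmn K)

variable {D hm} in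
theorem interpAt_mem {S : Subfield K} (hbr : ∀ α ∈ realRoots hmn, D.br α ∈ S)
    (hf : ∀ i, D.f i ∈ S) {i : Fin m} (hi : i ≠ lastIndex hm) :
    D.interpAt hm (branchNode hmn) i ∈ S := by
  have h1 := fun i => point_ne_branch (hmn := hmn) i
  have h2 : point hmn i ≠ point hmn (lastIndex hm) := fun h0 => hi (point_injective hmn h0)
  exact interp_mem (hbr _ (simpleRoot_mem_realRoots hmn _))
    (hbr _ (root_add_mem_realRoots hmn rfl _ le_rfl)) (hbr _ (ε_sub_mem_realRoots hm hmn (h1 i)))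
    (hbr _ (root_add_mem_realRoots hmn rfl _ le_rfl))
    (hbr _ (ε_sub_mem_realRoots hm hmn (h1 _))) (hbr _ (ε_sub_mem_realRoots hm hmn h2))
    (hf i) (hf _)

variable {D hm} in
theorem ratio_mem {S : Subfield K} (hτ : ∀ j, D.τ j ∈ S) : D.ratio hm ∈ S :=
  div_mem (hτ _) (hτ _)

variable {D} in
theorem fImage_mem {S : Subfield K} (hbr : ∀ α ∈ realRoots hmn, D.br α ∈ S)
    (hf : ∀ i, D.f i ∈ S) (hτ : ∀ j, D.τ j ∈ S) (k : Fin n) (i : Fin m) :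
    D.fImage hm k i ∈ S := by
  by_cases hk : (k : ℕ) = 0
  · rw [fImage_zero hk]; exact inv_mem (hf i)
  rcases lt_trichotomy (k : ℕ) m with hkm | hkm | hkm
  · rw [fImage_lt hk hkm]; exact hf _
  · obtain rfl : k = branchNode hmn := Fin.ext hkm
    by_cases hi : i = lastIndex hm
    · subst hi
      rw [fImage_branch_last]; exact mul_mem (ratio_mem hτ) (hf _)
    · rw [fImage_branch hi]; exact mul_mem (ratio_mem hτ) (interpAt_mem hbr hf hi)
  · rw [fImage_gt hkm]; exact hf i

variable {D} in
theorem τImage_mem {S : Subfield K} (hf : ∀ i, D.f i ∈ S) (hτ : ∀ j, D.τ j ∈ S)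
    (k j : Fin n) : D.τImage k j ∈ S := by
  by_cases hk : (k : ℕ) = 0
  · by_cases hj : (j : ℕ) < m
    · obtain ⟨i, rfl⟩ : ∃ i : Fin m, j = point hmn i := ⟨⟨j, hj⟩, rfl⟩
      rw [τImage_zero_point hk]; exact mul_mem (hτ _) (hf _)
    · rw [τImage_zero_ge hk (by omega)]; exact hτ _
  · rw [τImage_pos hk]; exact hτ _

variable {D} in
/-- The variables are rational in their prescribed images. -/
theorem mem_of_image_mem {S : Subfield K} (hbr : ∀ α, D.br α ∈ S) {k : Fin n}
    (hf : ∀ i, D.fImage hm k i ∈ S) (hτ : ∀ j, D.τImage k j ∈ S) :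
    (∀ i, D.f i ∈ S) ∧ ∀ j, D.τ j ∈ S := by
  by_cases hk : (k : ℕ) = 0
  · have h1 : ∀ i, D.f i ∈ S := fun i => by
      have := hf i
      rw [fImage_zero hk] at this
      exact inv_mem_iff.1 this
    refine ⟨h1, fun j => ?_⟩
    by_cases hj : (j : ℕ) < m
    · obtain ⟨i, rfl⟩ : ∃ i : Fin m, j = point hmn i := ⟨⟨j, hj⟩, rfl⟩
      have h2 := hτ (point hmn i)
      rw [τImage_zero_point hk] at h2
      rw [← mul_inv_cancel_right₀ (D.f_ne_zero i) (D.τ (point hmn i))]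
      exact mul_mem h2 (inv_mem (h1 i))
    · have h2 := hτ j
      rwa [τImage_zero_ge hk (by omega)] at h2
  have h1 : ∀ j, D.τ j ∈ S := fun j => by
    have h2 := hτ (adjSwap k j)
    rwa [τImage_pos hk, adjSwap_adjSwap] at h2
  refine ⟨?_, h1⟩
  rcases lt_trichotomy (k : ℕ) m with hkm | hkm | hkm
  · intro i
    have h2 := hf (adjSwap ⟨k, hkm⟩ i)
    rwa [fImage_lt hk hkm, adjSwap_adjSwap] at h2
  · obtain rfl : k = branchNode hmn := Fin.ext hkm
    have h2 : ∀ x, D.ratio hm * x ∈ S → x ∈ S := fun x hx => by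
      rw [← inv_mul_cancel_left₀ (ratio_ne_zero (hm := hm) (D := D)) x]
      exact mul_mem (inv_mem (ratio_mem h1)) hx
    have h3 : D.f (lastIndex hm) ∈ S := h2 _ (by
      have := hf (lastIndex hm)
      rwa [fImage_branch_last] at this)
    intro i
    by_cases hi : i = lastIndex hm
    · rw [hi]; exact h3
    have h4 : D.interpAt hm (branchNode hmn) i ∈ S := h2 _ (by
      have := hf i
      rwa [fImage_branch hi] at this)
    -- The formula for s_m is inverted by interpolating from the new point back to the old one, with
    -- α shifted accordingly.
    have h5 := interp_mem (x := ε m (point hmn i).succ) (y := ε m (branchNode hmn).succ)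
      (z := ε m (point hmn (lastIndex hm)).succ)
      (α := simpleRoot m (zeroNode hmn) +
        (ε m (point hmn (lastIndex hm)).succ - ε m (branchNode hmn).succ))
      (hbr _) (hbr _) (hbr _) (hbr _) (hbr _) (hbr _) h4 h3
    rwa [interpAt, interp_interp_right D.br_riemann br_root_ne_zero
      (D.br_shift_ne_zero hm) (br_point_sub_ne_zero hi) (br_sub_ne_zero (point_ne_branch i)),
      interp_self D.br_zero br_root_ne_zero (br_point_sub_ne_zero hi)] at h5
  · intro i
    have h2 := hf i
    rwa [fImage_gt hkm] at h2

end CremonaData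

/-! ### Coxeter relations as braid and commutation relations. -/

theorem braid_of_pow_three {G : Type*} [Group G] {a b : G} (ha : a * a = 1) (hb : b * b = 1)
    (h : (a * b) ^ 3 = 1) : a * b * a = b * a * b := by
  have ha' : a⁻¹ = a := inv_eq_of_mul_eq_one_left ha
  have hb' : b⁻¹ = b := inv_eq_of_mul_eq_one_left hb
  have h1 : (a * b * a) * (b * a * b) = 1 := by rw [← h]; simp only [pow_succ, pow_zero]; group
  rw [← inv_eq_of_mul_eq_one_right h1, mul_inv_rev, mul_inv_rev, ha', hb', mul_assoc]

theorem comm_of_sq {G : Type*} [Group G] {a b : G} (ha : a * a = 1) (hb : b * b = 1)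
    (h : (a * b) ^ 2 = 1) : a * b = b * a := by
  have ha' : a⁻¹ = a := inv_eq_of_mul_eq_one_left ha
  have hb' : b⁻¹ = b := inv_eq_of_mul_eq_one_left hb
  rw [sq] at h
  rw [← inv_eq_of_mul_eq_one_right h, mul_inv_rev, ha', hb']

theorem pow_three_of_braid {G : Type*} [Monoid G] {a b : G} (ha : a * a = 1) (hb : b * b = 1)
    (h : a * b * a = b * a * b) : (a * b) ^ 3 = 1 :=
  calc (a * b) ^ 3 = (a * b * a) * (b * a * b) := by simp only [pow_succ, pow_zero, one_mul, mul_assoc]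
    _ = b * a * (b * b) * a * b := by rw [h]; simp only [mul_assoc]
    _ = b * (a * a) * b := by rw [hb]; simp only [mul_one, mul_assoc]
    _ = 1 := by rw [ha, mul_one, hb]

theorem sq_of_comm {G : Type*} [Monoid G] {a b : G} (ha : a * a = 1) (hb : b * b = 1)
    (h : a * b = b * a) : (a * b) ^ 2 = 1 :=
  calc (a * b) ^ 2 = a * b * (b * a) := by rw [sq]; nth_rw 2 [h]
    _ = a * (b * b) * a := by simp only [mul_assoc]
    _ = 1 := by rw [hb, mul_one, ha]

section Relations

variable {m n : ℕ}

theorem weyl_sq (k : Fin n) : s m k * s m k = 1 :=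
  (coxeterMatrix m n).toCoxeterSystem.simple_mul_simple_self k

open scoped Classical in
theorem weyl_relation (k l : Fin n) :
    (s m k * s m l) ^ (if k = l then 1 else if Adjacent m k l then 3 else 2) = 1 :=
  (coxeterMatrix m n).toCoxeterSystem.simple_mul_simple_pow k l

theorem weyl_braid {k l : Fin n} (hkl : k ≠ l) (h : Adjacent m k l) :
    s m k * s m l * s m k = s m l * s m k * s m l := by
  classical
  have h1 := weyl_relation (m := m) k l
  rw [if_neg hkl, if_pos h] at h1
  exact braid_of_pow_three (weyl_sq k) (weyl_sq l) h1

theorem weyl_comm {k l : Fin n} (hkl : k ≠ l) (h : ¬ Adjacent m k l) :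
    s m k * s m l = s m l * s m k := by
  classical
  have h1 := weyl_relation (m := m) k l
  rw [if_neg hkl, if_neg h] at h1
  exact comm_of_sq (weyl_sq k) (weyl_sq l) h1

theorem isLiftable_of_relations {G : Type*} [Monoid G] (S : Fin n → G) (h1 : ∀ k, S k * S k = 1)
    (h2 : ∀ k l : Fin n, (k : ℕ) < l → Adjacent m k l → S k * S l * S k = S l * S k * S l)
    (h3 : ∀ k l : Fin n, (k : ℕ) < l → ¬ Adjacent m k l → S k * S l = S l * S k) :
    (coxeterMatrix m n).IsLiftable S := by
  classical
  intro k l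
  change _ ^ (if k = l then 1 else if Adjacent m k l then 3 else 2) = _
  by_cases hkl : k = l
  · subst hkl
    rw [if_pos rfl, pow_one, h1]
  have hsymm : Adjacent m k l ↔ Adjacent m l k := by unfold Adjacent; tauto
  have hne : (k : ℕ) ≠ l := fun h0 => hkl (Fin.ext h0)
  rw [if_neg hkl]
  by_cases ha : Adjacent m k l
  · rw [if_pos ha]
    refine pow_three_of_braid (h1 k) (h1 l) ?_
    rcases lt_or_gt_of_ne hne with h | h
    · exact h2 k l h ha
    · exact (h2 l k h (hsymm.1 ha)).symm
  · rw [if_neg ha]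
    refine sq_of_comm (h1 k) (h1 l) ?_
    rcases lt_or_gt_of_ne hne with h | h
    · exact h3 k l h ha
    · exact (h3 l k h (fun h0 => ha (hsymm.2 h0))).symm

/-- On coefficients each relation is inherited from the group acting through `σ`; on the variables
it is one of the computations above. The hypothesis `hext` says that coefficients and variables
determine an endomorphism. -/
theorem CremonaData.isLiftable {hmn : m < n} (hm : 0 < m) {F K : Type*} [Field F] [Field K]
    [Algebra ℂ F] [Algebra ℂ K] (D : CremonaData hmn K) (C : F → K)
    (σ : Weyl m n →* (F ≃ₐ[ℂ] F)) (S : Fin n → (K →ₐ[ℂ] K))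
    (hC : ∀ k c, S k (C c) = C (σ (s m k) c)) (hS : ∀ k, D.IsRefl hm k (S k : K →+* K))
    (hext : ∀ φ ψ : K →ₐ[ℂ] K, (∀ c, φ (C c) = ψ (C c)) → (∀ i, φ (D.f i) = ψ (D.f i)) →
      (∀ j, φ (D.τ j) = ψ (D.τ j)) → φ = ψ) : (coxeterMatrix m n).IsLiftable S := by
  refine isLiftable_of_relations S (fun k => ?_) (fun k l hkl ha => ?_) fun k l hkl ha => ?_
  · refine hext _ _ (fun c => ?_) (hS k).sq_f (hS k).sq_τ
    rw [AlgHom.mul_apply, hC, hC, ← algAction_mul, weyl_sq, map_one, AlgEquiv.one_apply,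
      AlgHom.one_apply]
  · have hne : k ≠ l := fun h0 => by rw [h0] at hkl; omega
    have hcoef : ∀ c, (S k * S l * S k) (C c) = (S l * S k * S l) (C c) := fun c => by
      simp only [AlgHom.mul_apply, hC]
      rw [← algAction_mul, ← algAction_mul, ← algAction_mul, ← algAction_mul, weyl_braid hne ha]
    by_cases hk : (k : ℕ) = 0
    · have hl : (l : ℕ) = m := by unfold Adjacent at ha; omega
      obtain rfl : k = zeroNode hmn := Fin.ext hk
      obtain rfl : l = branchNode hmn := Fin.ext hl
      exact hext _ _ hcoef ((hS _).zero_braid_f (hS _)) ((hS _).zero_braid_τ (hS _))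
    · have hl : (l : ℕ) = k + 1 := by unfold Adjacent at ha; omega
      exact hext _ _ hcoef ((hS _).braid_f (hS _) hk hl) ((hS _).braid_τ (hS _) hk hl)
  · have hne : k ≠ l := fun h0 => by rw [h0] at hkl; omega
    have h0 : (k : ℕ) = 0 → (l : ℕ) ≠ m := by unfold Adjacent at ha; omega
    have h1 : (k : ℕ) ≠ 0 → (k : ℕ) + 1 ≠ l := by unfold Adjacent at ha; omega
    refine hext _ _ (fun c => ?_) ((hS _).comm_f (hS _) hkl h0 h1)
      ((hS _).comm_τ (hS _) hkl h0 h1)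
    simp only [AlgHom.mul_apply, hC]
    rw [← algAction_mul, ← algAction_mul, weyl_comm hne ha]

end Relations

/-! ### Restriction of an action to a subfield. -/

theorem map_adjoin_mem {F K : Type*} [Field F] [Field K] [Algebra F K] {t : Set K} (φ : K →+* K)
    (h1 : ∀ c, φ (algebraMap F K c) ∈ IntermediateField.adjoin F t)
    (h2 : ∀ x ∈ t, φ x ∈ IntermediateField.adjoin F t) {x : K}
    (hx : x ∈ IntermediateField.adjoin F t) : φ x ∈ IntermediateField.adjoin F t := by
  induction hx using IntermediateField.adjoin_induction with
  | mem x hx => exact h2 x hx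
  | algebraMap c => exact h1 c
  | add x y _ _ hx hy => rw [map_add]; exact add_mem hx hy
  | inv x _ hx => rw [map_inv₀]; exact inv_mem hx
  | mul x y _ _ hx hy => rw [map_mul]; exact mul_mem hx hy

/-- An action by endomorphisms which preserves a subfield restricts to an action by automorphisms
of the subfield. -/
theorem exists_restrict_action {R E K G : Type*} [CommSemiring R] [Field E] [Field K] [Algebra E K]
    [Algebra R E] [Algebra R K] [IsScalarTower R E K] [Group G] (T : IntermediateField E K)
    (r : G →* (K →ₐ[R] K)) (hT : ∀ g x, x ∈ T → r g x ∈ T) :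
    ∃ ρ : G →* (T ≃ₐ[R] T), ∀ g (x : T), (ρ g x : K) = r g x := by
  let res : G →* (T →ₐ[R] T) :=
    { toFun := fun g =>
        { toFun := fun x => ⟨r g x, hT g x x.2⟩
          map_one' := Subtype.ext (map_one (r g))
          map_mul' := fun x y => Subtype.ext (map_mul (r g) (x : K) y)
          map_zero' := Subtype.ext (map_zero (r g))
          map_add' := fun x y => Subtype.ext (map_add (r g) (x : K) y)
          commutes' := fun c => Subtype.ext ((r g).commutes c) }
      map_one' := AlgHom.ext fun x => Subtype.ext (by
        change r 1 x = x
        rw [map_one]; rfl)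
      map_mul' := fun g g' => AlgHom.ext fun x => Subtype.ext (by
        change r (g * g') x = r g (r g' x)
        rw [map_mul]; rfl) }
  -- A homomorphism from a group to the monoid of endomorphisms takes values in the units, which are
  -- the automorphisms; no inverse has to be exhibited.
  exact ⟨(AlgEquiv.algHomUnitsEquiv R T).toMonoidHom.comp res.toHomUnits, fun g x => rfl⟩

/-! ## The action on the field of `τ`-functions -/

section Action

variable {m n : ℕ} (b : Bracket) (hmn : m < n) (hm : 0 < m)

theorem Bracket.coeff_zero (m n : ℕ) : b.coeff m (0 : Module.Dual ℂ (Cartan n)) = 0 := by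
  have h0 : b.holo (0 : Module.Dual ℂ (Cartan n)) = 0 := by
    refine Subtype.ext (funext fun v => ?_)
    change b.toFun 0 = 0
    have h1 := b.odd 0
    rw [neg_zero] at h1
    exact self_eq_neg.1 h1
  rw [Bracket.coeff_eq, h0, RingHom.map_zero]

theorem fVar_ne_zero (i : Fin m) : (fVar i : Ambient m n) ≠ 0 := fun h0 =>
  MvPolynomial.X_ne_zero (R := Mero n) (Sum.inl i : Fin m ⊕ Fin n)
    (IsFractionRing.injective _ (Ambient m n) (h0.trans (RingHom.map_zero _).symm))

theorem τVar_ne_zero (j : Fin n) : (τVar j : Ambient m n) ≠ 0 := fun h0 =>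
  MvPolynomial.X_ne_zero (R := Mero n) (Sum.inr j : Fin m ⊕ Fin n)
    (IsFractionRing.injective _ (Ambient m n) (h0.trans (RingHom.map_zero _).symm))

/-- The field of rational functions in the `f` and `τ` variables with its brackets. -/
def ambientData : CremonaData hmn (Ambient m n) where
  br := b.coeff m
  f := fVar
  τ := τVar
  br_zero := b.coeff_zero m n
  br_neg := b.coeff_neg m
  br_ne_zero _ := b.coeff_ne_zero m
  br_riemann := b.coeff_riemann' m
  f_ne_zero := fVar_ne_zero
  τ_ne_zero := τVar_ne_zero

/-- The extension theorem applies since the variables can be recovered from their images with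
brackets as constants. Over `Mero n` all brackets are constants, not only those of real roots. -/
theorem exists_reflHom (k : Fin n) : ∃ φ : Ambient m n →+* Ambient m n,
    (∀ c, φ (algebraMap (Mero n) (Ambient m n) c) =
      algebraMap (Mero n) (Ambient m n) (weylMero hmn (s m k) c)) ∧
    (ambientData b hmn).IsRefl hm k φ := by
  let y : Fin m ⊕ Fin n → Ambient m n :=
    Sum.elim ((ambientData b hmn).fImage hm k) ((ambientData b hmn).τImage k)
  let A := IntermediateField.adjoin (Mero n) (Set.range y)
  have hy : ∀ i, y i ∈ A := fun i => IntermediateField.subset_adjoin _ _ ⟨i, rfl⟩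
  have hmem := CremonaData.mem_of_image_mem hm (D := ambientData b hmn) (S := A.toSubfield)
    (fun α => A.algebraMap_mem _) (k := k) (fun i => hy (Sum.inl i)) (fun j => hy (Sum.inr j))
  obtain ⟨φ, h1, h2⟩ := exists_semilinear_endomorphism (F := Mero n) (K := Ambient m n)
    ((weylMero hmn (s m k)).toAlgHom.toRingHom) y
    (Sum.rec (fun i => hmem.1 i) (fun j => hmem.2 j))
  refine ⟨φ, h1, fun α => ?_, fun i => h2 (Sum.inl i), fun j => h2 (Sum.inr j)⟩
  refine (h1 (b.mero α)).trans ?_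
  exact congrArg (algebraMap (Mero n) (Ambient m n)) (weylMero_mero hmn b (s m k) α)

/-- The endomorphism by which `s_k` acts on the field of all rational functions. -/
def reflHom (k : Fin n) : Ambient m n →+* Ambient m n := (exists_reflHom b hmn hm k).choose

theorem reflHom_algebraMap (k : Fin n) (c : Mero n) :
    reflHom b hmn hm k (algebraMap (Mero n) (Ambient m n) c) =
      algebraMap (Mero n) (Ambient m n) (weylMero hmn (s m k) c) :=
  (exists_reflHom b hmn hm k).choose_spec.1 c

theorem reflHom_isRefl (k : Fin n) : (ambientData b hmn).IsRefl hm k (reflHom b hmn hm k) :=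
  (exists_reflHom b hmn hm k).choose_spec.2

theorem algebraMap_ambient (c : ℂ) : algebraMap ℂ (Ambient m n) c =
    algebraMap (Mero n) (Ambient m n) (algebraMap ℂ (Mero n) c) :=
  IsScalarTower.algebraMap_apply ℂ (Mero n) (Ambient m n) c

/-- `reflHom` as a `ℂ`-algebra homomorphism. -/
def reflAlgHom (k : Fin n) : Ambient m n →ₐ[ℂ] Ambient m n where
  __ := reflHom b hmn hm k
  commutes' c := by
    rw [algebraMap_ambient]
    refine (reflHom_algebraMap b hmn hm k _).trans ?_
    exact congrArg _ ((weylMero hmn (s m k)).commutes c)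

theorem reflAlgHom_isLiftable : (coxeterMatrix m n).IsLiftable (reflAlgHom b hmn hm) := by
  refine CremonaData.isLiftable (F := Mero n) hm (ambientData b hmn) (algebraMap (Mero n) (Ambient m n))
    (weylMero hmn) _ (fun k c => reflHom_algebraMap b hmn hm k c)
    (fun k => reflHom_isRefl b hmn hm k) fun φ ψ hc hf hτ => ?_
  have h1 : (φ : Ambient m n →+* Ambient m n) = ψ :=
    ringHom_ext_rational (ι := Fin m ⊕ Fin n) (F := Mero n) hc
      (Sum.rec (fun i => hf i) (fun j => hτ j))
  exact AlgHom.ext fun x => RingHom.congr_fun h1 x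

/-- The action on the field of all rational functions. -/
def ambientAction : Weyl m n →* (Ambient m n →ₐ[ℂ] Ambient m n) :=
  (coxeterMatrix m n).toCoxeterSystem.lift ⟨reflAlgHom b hmn hm, reflAlgHom_isLiftable b hmn hm⟩

theorem ambientAction_s (k : Fin n) :
    ambientAction b hmn hm (s m k) = reflAlgHom b hmn hm k :=
  (coxeterMatrix m n).toCoxeterSystem.lift_apply_simple (reflAlgHom_isLiftable b hmn hm) k

theorem weylMero_mem_coeffField (w : Weyl m n) {c : Mero n} (hc : c ∈ coeffField b hmn) :
    weylMero hmn w c ∈ coeffField b hmn := by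
  refine map_adjoin_mem ((weylMero hmn w).toAlgHom.toRingHom) (fun r => ?_) ?_ hc
  · have h1 : weylMero hmn w (algebraMap ℂ (Mero n) r) = algebraMap ℂ (Mero n) r :=
      (weylMero hmn w).commutes r
    change weylMero hmn w (algebraMap ℂ (Mero n) r) ∈ _
    rw [h1]
    exact IntermediateField.algebraMap_mem _ r
  · rintro _ ⟨α, hα, rfl⟩
    change weylMero hmn w (b.mero α) ∈ _
    rw [weylMero_mero]
    exact IntermediateField.subset_adjoin _ _ ⟨_, weylDual_mem hmn w hα, rfl⟩

theorem coeff_mem_tauField {α : Module.Dual ℂ (Cartan n)} (hα : α ∈ realRoots hmn) :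
    b.coeff m α ∈ tauField (m := m) (n := n) b hmn :=
  (rootElt b hmn α hα).2

/-- The images of the variables use brackets at real roots only, and W permutes the real roots, so
the generators of 𝓛 stay in 𝓛. -/
theorem reflHom_mem (k : Fin n) {x : Ambient m n} (hx : x ∈ tauField b hmn) :
    reflHom b hmn hm k x ∈ tauField b hmn := by
  refine map_adjoin_mem (F := coeffField b hmn) (K := Ambient m n)
    (reflHom (m := m) (n := n) b hmn hm k) (fun c => ?_) ?_ hx
  · have h1 : reflHom b hmn hm k (algebraMap (coeffField b hmn) (Ambient m n) c) =
        algebraMap (coeffField b hmn) (Ambient m n)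
          ⟨weylMero hmn (s m k) c, weylMero_mem_coeffField b hmn _ c.2⟩ :=
      reflHom_algebraMap b hmn hm k c
    rw [h1]
    exact IntermediateField.algebraMap_mem _ _
  · have hf : ∀ i, (ambientData b hmn).f i ∈ (tauField b hmn).toSubfield :=
      fun i => (fElt b hmn i).2
    have hτ : ∀ j, (ambientData b hmn).τ j ∈ (tauField b hmn).toSubfield :=
      fun j => (τElt b hmn j).2
    rintro _ (⟨i, rfl⟩ | ⟨j, rfl⟩)
    · have h1 : reflHom b hmn hm k (fVar i) = _ := (reflHom_isRefl b hmn hm k).f i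
      rw [h1]
      exact CremonaData.fImage_mem hm (D := ambientData b hmn) (S := (tauField b hmn).toSubfield)
        (fun α hα => coeff_mem_tauField b hmn hα) hf hτ k i
    · have h1 : reflHom b hmn hm k (τVar j) = _ := (reflHom_isRefl b hmn hm k).τ j
      rw [h1]
      exact CremonaData.τImage_mem (D := ambientData b hmn) (S := (tauField b hmn).toSubfield)
        hf hτ k j

theorem ambientAction_mem (w : Weyl m n) {x : Ambient m n} (hx : x ∈ tauField b hmn) :
    ambientAction b hmn hm w x ∈ tauField b hmn := by
  induction w using (coxeterMatrix m n).toCoxeterSystem.simple_induction_left generalizing x with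
  | one =>
    have h1 : ambientAction b hmn hm 1 x = x := by rw [map_one]; rfl
    rwa [h1]
  | mul_simple_left w k ih =>
    have h1 : ambientAction b hmn hm (s m k * w) x =
        reflHom b hmn hm k (ambientAction b hmn hm w x) := by
      rw [map_mul, ambientAction_s]; rfl
    exact h1 ▸ reflHom_mem b hmn hm k (ih hx)

end Action

/-! ## Existence and uniqueness of the action -/

theorem ringHom_ext_adjoin {F K L : Type*} [Field F] [Field K] [Algebra F K] [Field L] {t : Set K}
    {φ ψ : IntermediateField.adjoin F t →+* L}
    (h1 : ∀ c, φ (algebraMap F _ c) = ψ (algebraMap F _ c))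
    (h2 : ∀ x (hx : x ∈ t), φ ⟨x, IntermediateField.subset_adjoin F t hx⟩ =
      ψ ⟨x, IntermediateField.subset_adjoin F t hx⟩) : φ = ψ := by
  refine RingHom.ext fun ⟨x, hx⟩ => ?_
  induction hx using IntermediateField.adjoin_induction with
  | mem x hx => exact h2 x hx
  | algebraMap c => exact h1 c
  | add x y hx hy h h' =>
    exact (map_add φ ⟨x, hx⟩ ⟨y, hy⟩).trans ((congrArg₂ _ h h').trans
      (map_add ψ ⟨x, hx⟩ ⟨y, hy⟩).symm)
  | inv x hx h => exact (map_inv₀ φ ⟨x, hx⟩).trans ((congrArg _ h).trans (map_inv₀ ψ ⟨x, hx⟩).symm)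
  | mul x y hx hy h h' =>
    exact (map_mul φ ⟨x, hx⟩ ⟨y, hy⟩).trans ((congrArg₂ _ h h').trans
      (map_mul ψ ⟨x, hx⟩ ⟨y, hy⟩).symm)

theorem CremonaData.fImage_branch_eq {m n : ℕ} {hmn : m < n} {hm : 0 < m} {K : Type*} [Field K]
    {D : CremonaData hmn K} {i : Fin m} (hi : i ≠ lastIndex hm) :
    D.fImage hm (branchNode hmn) i =
      D.τ (point hmn (lastIndex hm)) / D.τ (branchNode hmn) *
        ((D.br (simpleRoot m (zeroNode hmn) + εDiff m (point hmn (lastIndex hm)) (branchNode hmn)) *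
              D.br (εDiff m (point hmn i) (branchNode hmn)) * D.f i
            - D.br (simpleRoot m (zeroNode hmn) + εDiff m (point hmn i) (branchNode hmn)) *
              D.br (εDiff m (point hmn (lastIndex hm)) (branchNode hmn)) * D.f (lastIndex hm)) /
          (D.br (simpleRoot m (zeroNode hmn)) *
            D.br (εDiff m (point hmn i) (point hmn (lastIndex hm))))) :=
  fImage_branch hi

section ExistsUnique

variable {m n : ℕ} (b : Bracket) (hmn : m < n)

set_option maxHeartbeats 1000000 in
theorem exists_tauAction (hm : 0 < m) : ∃ ρ : Weyl m n →* (tauField b hmn ≃ₐ[ℂ] tauField b hmn),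
    IsTauAction b hmn ρ := by
  obtain ⟨ρ, hρ⟩ := exists_restrict_action (R := ℂ) (E := coeffField b hmn) (K := Ambient m n)
    (tauField b hmn) (ambientAction b hmn hm) (fun w x hx => ambientAction_mem b hmn hm w hx)
  have hs : ∀ k x, (ρ (s m k) x : Ambient m n) = reflHom b hmn hm k x := fun k x => by
    refine (hρ _ x).trans ?_
    rw [ambientAction_s]; rfl
  have hR := reflHom_isRefl b hmn hm
  have hf : ∀ k i, (ρ (s m k) (fElt b hmn i) : Ambient m n) =
      (ambientData b hmn).fImage hm k i := fun k i => (hs k _).trans ((hR k).f i)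
  have hτ : ∀ k j, (ρ (s m k) (τElt b hmn j) : Ambient m n) =
      (ambientData b hmn).τImage k j := fun k j => (hs k _).trans ((hR k).τ j)
  refine ⟨ρ, ?_⟩
  constructor
  · intro k α hα
    exact Subtype.ext ((hs k _).trans ((hR k).br α))
  · intro k hk i
    exact Subtype.ext ((hτ k _).trans (CremonaData.τImage_zero_point hk i))
  · intro k hk j hj
    exact Subtype.ext ((hτ k _).trans (CremonaData.τImage_zero_ge hk hj))
  · intro k hk j
    exact Subtype.ext ((hτ k _).trans (CremonaData.τImage_pos hk j))
  · intro k hk i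
    exact Subtype.ext ((hf k _).trans (CremonaData.fImage_zero hk i))
  · intro k hk i
    exact Subtype.ext ((hf _ _).trans (CremonaData.fImage_lt (k := point hmn k) hk k.2 i))
  · intro k hk i
    exact Subtype.ext ((hf k _).trans (CremonaData.fImage_gt hk i))
  · intro z c hz hc a ha i hi
    obtain rfl : z = zeroNode hmn := Fin.ext hz
    obtain rfl : c = branchNode hmn := Fin.ext hc
    obtain rfl : a = lastIndex hm := Fin.ext (by rw [lastIndex_val]; omega)
    exact (hf _ _).trans (CremonaData.fImage_branch_eq hi)
  · intro c hc a ha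
    obtain rfl : c = branchNode hmn := Fin.ext hc
    obtain rfl : a = lastIndex hm := Fin.ext (by rw [lastIndex_val]; omega)
    exact (hf _ _).trans CremonaData.fImage_branch_last

/-- The field is generated in two stages, 𝕂 over ℂ by brackets and 𝓛 over 𝕂 by the variables, and
agreement is propagated through each stage in turn. -/
theorem tauField_algEquiv_ext {φ ψ : tauField b hmn ≃ₐ[ℂ] tauField b hmn}
    (h1 : ∀ α (hα : α ∈ realRoots hmn), φ (rootElt b hmn α hα) = ψ (rootElt b hmn α hα))
    (h2 : ∀ i, φ (fElt b hmn i) = ψ (fElt b hmn i))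
    (h3 : ∀ j, φ (τElt b hmn j) = ψ (τElt b hmn j)) : φ = ψ := by
  let E := coeffField b hmn
  let T := tauField b hmn
  have hcoef : ((φ : T →+* T).comp (algebraMap E T)) = ((ψ : T →+* T).comp (algebraMap E T)) := by
    refine ringHom_ext_adjoin (fun c => ?_) ?_
    · exact (φ.commutes c).trans (ψ.commutes c).symm
    · rintro _ ⟨α, hα, rfl⟩
      exact h1 α hα
  have hall : (φ : T →+* T) = ψ := by
    refine ringHom_ext_adjoin (fun c => RingHom.congr_fun hcoef c) ?_
    rintro _ (⟨i, rfl⟩ | ⟨j, rfl⟩)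
    · exact h2 i
    · exact h3 j
  exact AlgEquiv.ext fun x => RingHom.congr_fun hall x

theorem tauAction_unique (hm : 0 < m) {ρ ρ' : Weyl m n →* (tauField b hmn ≃ₐ[ℂ] tauField b hmn)}
    (hρ : IsTauAction b hmn ρ) (hρ' : IsTauAction b hmn ρ') : ρ = ρ' := by
  refine (coxeterMatrix m n).toCoxeterSystem.ext_simple fun k => ?_
  have key : ρ (s m k) = ρ' (s m k) := by
    refine tauField_algEquiv_ext b hmn (fun α hα => ?_) (fun i => ?_) (fun j => ?_)
    · exact (hρ.root k α hα).trans (hρ'.root k α hα).symm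
    · by_cases hk : (k : ℕ) = 0
      · exact (hρ.s_zero_f k hk i).trans (hρ'.s_zero_f k hk i).symm
      rcases lt_trichotomy (k : ℕ) m with hkm | hkm | hkm
      · exact (hρ.s_lt_f ⟨k, hkm⟩ hk i).trans (hρ'.s_lt_f ⟨k, hkm⟩ hk i).symm
      · have ha : (lastIndex hm : ℕ) + 1 = m := by rw [lastIndex_val]; omega
        by_cases hi : i = lastIndex hm
        · subst hi
          exact Subtype.ext ((hρ.s_m_f_m k hkm _ ha).trans (hρ'.s_m_f_m k hkm _ ha).symm)
        · exact Subtype.ext ((hρ.s_m_f (zeroNode hmn) k rfl hkm _ ha i hi).trans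
            (hρ'.s_m_f (zeroNode hmn) k rfl hkm _ ha i hi).symm)
      · exact (hρ.s_gt_f k hkm i).trans (hρ'.s_gt_f k hkm i).symm
    · by_cases hk : (k : ℕ) = 0
      · by_cases hj : (j : ℕ) < m
        · exact (hρ.s_zero_τ_le k hk ⟨j, hj⟩).trans (hρ'.s_zero_τ_le k hk ⟨j, hj⟩).symm
        · exact (hρ.s_zero_τ_gt k hk j (by omega)).trans (hρ'.s_zero_τ_gt k hk j (by omega)).symm
      · exact (hρ.s_pos_τ k hk j).trans (hρ'.s_pos_τ k hk j).symm
  exact key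

end ExistsUnique

/-! ## The stabilizer of `eₙ` -/

section Stabilizer

variable {m n : ℕ} (hmn : m < n)

/-- The cone spanned by the vectors `h_k`. -/
def positiveCone (m n : ℕ) : AddSubmonoid (Lat n) :=
  AddSubmonoid.closure (Set.range fun k : Fin n => h ℤ m k)

/-- The length function of the Weyl group. -/
def weylLength (w : Weyl m n) : ℕ := (coxeterMatrix m n).toCoxeterSystem.length w

theorem weyl_mul_s_s (w : Weyl m n) (k : Fin n) : w * s m k * s m k = w := by
  rw [mul_assoc, weyl_sq, mul_one]

/-- If `s_k` is not a right descent of `w` then `w.h_k` lies in the positive cone. -/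
theorem weylRep_h_mem_positiveCone (w : Weyl m n) (k : Fin n)
    (hw : weylLength w < weylLength (w * s m k)) :
    weylRep ℤ hmn w (h ℤ m k) ∈ positiveCone m n := by
  classical
  have hmul : ∀ (u : Weyl m n) (t : Fin n), weylLength (u * s m t) = weylLength u + 1 ∨ weylLength (u * s m t) + 1 = weylLength u :=
    fun u t => (coxeterMatrix m n).toCoxeterSystem.length_mul_simple u t
  induction hN : weylLength w using Nat.strong_induction_on
    generalizing w k with
  | _ N ih =>
    subst hN
    by_cases h1 : w = 1
    · subst h1
      rw [map_one, Module.End.one_apply]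
      exact AddSubmonoid.subset_closure ⟨k, rfl⟩
    obtain ⟨t, ht⟩ := (coxeterMatrix m n).toCoxeterSystem.exists_rightDescent_of_ne_one h1
    have ht : weylLength (w * s m t) < weylLength w := ht
    have hkt : k ≠ t := by
      rintro rfl
      omega
    obtain ⟨v, hv⟩ : ∃ v, v = w * s m t := ⟨_, rfl⟩
    have hwv : w = v * s m t := by rw [hv, weyl_mul_s_s]
    rw [← hv] at ht
    have htk := form_h_ne (R := ℤ) (m := m) t k hkt.symm
    have ha : Adjacent m t k ↔ Adjacent m k t := by unfold Adjacent; tauto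
    rw [hwv, map_mul, Module.End.mul_apply, weylRep_s, htk]
    have hvt : weylLength v < weylLength (v * s m t) := by rwa [← hwv]
    -- For adjacent nodes w.h_k = v.h_k + v.h_t, otherwise w.h_k = v.h_k.
    by_cases hadj : Adjacent m t k
    · rw [if_pos hadj]
      have hvk := hmul v k
      rcases lt_or_ge (weylLength v) (weylLength (v * s m k)) with h2 | h2
      · have e1 := ih _ ht v k h2 rfl
        have e2 := ih _ ht v t hvt rfl
        rw [map_sub, map_smul, neg_one_smul, sub_neg_eq_add]
        exact add_mem e1 e2
      -- If v.h_k is not available by induction, then v = u s_k with u shorter, and w.h_k = u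
      -- s_k.(h_k + h_t) = u.h_t.
      · obtain ⟨u, hu⟩ : ∃ u, u = v * s m k := ⟨_, rfl⟩
        have hvu : v = u * s m k := by rw [hu, weyl_mul_s_s]
        have huv : weylLength u < weylLength v := by rw [hu]; omega
        have hut : weylLength u < weylLength (u * s m t) := by
          have h3 := hmul u t
          by_contra hcon
          -- If s_t shortened u, this braid rewriting would give w s_k at most the length of v,
          -- against the assumption that it is longer than w.
          have h4 : w * s m k = u * s m t * s m k * s m t := by
            rw [hwv, hvu, mul_assoc, mul_assoc, ← mul_assoc (s m k), weyl_braid hkt (ha.1 hadj)]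
            simp only [mul_assoc]
          have h5 := hmul (u * s m t) k
          have h6 := hmul (u * s m t * s m k) t
          rw [← h4] at h6
          have h7 := hmul w t
          omega
        have e3 := ih _ (huv.trans ht) u t hut rfl
        have h8 := form_h_ne (R := ℤ) (m := m) k t hkt
        rw [if_pos (ha.1 hadj)] at h8
        rw [neg_one_smul, sub_neg_eq_add, hvu, map_mul, Module.End.mul_apply, map_add, weylRep_s,
          weylRep_s, form_h_self hmn, h8]
        convert e3 using 2
        module
    · rw [if_neg hadj, zero_smul, sub_zero]
      refine ih _ ht v k ?_ rfl
      have h2 := hmul v k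
      by_contra hcon
      have h3 : w * s m k = v * s m k * s m t := by
        rw [hwv, mul_assoc, mul_assoc, weyl_comm hkt (fun h0 => hadj (ha.2 h0))]
      have h4 := hmul (v * s m k) t
      rw [← h3] at h4
      omega

theorem weylRep_form (w : Weyl m n) (x y : Lat n) :
    form ℤ m n (weylRep ℤ hmn w x) (weylRep ℤ hmn w y) = form ℤ m n x y := by
  induction w using (coxeterMatrix m n).toCoxeterSystem.simple_induction_left with
  | one => rw [map_one]; rfl
  | mul_simple_left w k ih =>
    change form ℤ m n (weylRep ℤ hmn (s m k * w) x) (weylRep ℤ hmn (s m k * w) y) = _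
    rw [map_mul, Module.End.mul_apply, Module.End.mul_apply, weylRep_s, weylRep_s, ← ih]
    simp only [map_sub, map_smul, LinearMap.sub_apply, LinearMap.smul_apply, smul_eq_mul,
      form_h_self hmn, form_comm _ (h ℤ m k)]
    ring

/-- Because m < n, the vector e_n does not occur in h_0, so only h_{n-1} = e_{n-1} - e_n meets it.
Thus e_n pairs nonpositively with the whole positive cone. -/
theorem form_h_last (hmn : m < n) (p k : Fin n) (hp : (p : ℕ) + 1 = n) (hm : 0 < m) :
    form ℤ m n (h ℤ m k) (e ℤ p.succ) = if (k : ℕ) + 1 = n then -1 else 0 := by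
  by_cases hk : (k : ℕ) = 0
  · rw [form_h_zero k hk, if_neg (by omega)]
    have h1 : (e ℤ p.succ : Lat n) 0 = 0 := by simp [e]
    rw [h1, mul_zero, zero_sub, neg_eq_zero]
    refine Finset.sum_eq_zero fun j _ => ?_
    split_ifs with hj
    · have : j ≠ p := fun h0 => by rw [h0] at hj; omega
      simp [e, this]
    · rfl
  · rw [form_h_e_pos k hk, Fin.val_succ, if_neg (by omega)]
    split_ifs <;> omega

/-- The stabilizer of `eₙ` is generated by the simple reflections in it. -/
theorem stabilizer_induction (hm : 0 < m) {P : Weyl m n → Prop} (p : Fin n) (hp : (p : ℕ) + 1 = n)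
    (one : P 1) (mul : ∀ w (k : Fin n), (k : ℕ) + 1 ≠ n → P w → P (w * s m k))
    (w : Weyl m n) (hw : weylRep ℤ hmn w (e ℤ p.succ) = e ℤ p.succ) : P w := by
  induction hN : weylLength w using Nat.strong_induction_on
    generalizing w with
  | _ N ih =>
    subst hN
    by_cases h1 : w = 1
    · rw [h1]; exact one
    obtain ⟨k, hk⟩ := (coxeterMatrix m n).toCoxeterSystem.exists_rightDescent_of_ne_one h1
    have hk : weylLength (w * s m k) < weylLength w := hk
    by_cases hkn : (k : ℕ) + 1 = n
    · exfalso
      -- A descent at n-1 is impossible: w s_k.h_k = -w.h_k would be in the cone, yet its pairing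
      -- with e_n = w.e_n is -(h_k|e_n) = 1.
      have h2 := weylRep_h_mem_positiveCone hmn (w * s m k) k (by rwa [weyl_mul_s_s])
      have h3 : ∀ x ∈ positiveCone m n, form ℤ m n x (e ℤ p.succ) ≤ 0 := by
        intro x hx
        induction hx using AddSubmonoid.closure_induction with
        | mem x hx =>
          obtain ⟨j, rfl⟩ := hx
          change form ℤ m n (h ℤ m j) _ ≤ 0
          rw [form_h_last hmn p j hp hm]
          split_ifs <;> omega
        | zero => simp
        | add x y _ _ h h' => rw [map_add, LinearMap.add_apply]; omega
      have h4 := h3 _ h2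
      rw [map_mul, Module.End.mul_apply, weylRep_s, form_h_self hmn] at h4
      rw [← hw, weylRep_form, map_sub, LinearMap.sub_apply, map_smul, LinearMap.smul_apply,
        form_h_last hmn p k hp hm, if_pos hkn] at h4
      norm_num at h4
    · have h2 : weylRep ℤ hmn (w * s m k) (e ℤ p.succ) = e ℤ p.succ := by
        rw [map_mul, Module.End.mul_apply, weylRep_s, form_h_last hmn p k hp hm, if_neg hkn, zero_smul,
          sub_zero, hw]
      have h3 := mul _ k hkn (ih _ hk (w * s m k) h2 rfl)
      rwa [weyl_mul_s_s] at h3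

end Stabilizer

/-! ## Lattice `τ`-functions -/

section LatticeTau

variable {m n : ℕ} {b : Bracket} {hmn : m < n}
  {ρ : Weyl m n →* (tauField b hmn ≃ₐ[ℂ] tauField b hmn)}

theorem IsTauAction.root_apply (hρ : IsTauAction b hmn ρ) (w : Weyl m n)
    {α : Module.Dual ℂ (Cartan n)} (hα : α ∈ realRoots hmn) :
    ρ w (rootElt b hmn α hα) =
      rootElt b hmn (weylDual hmn w α) (weylDual_mem hmn w hα) := by
  have hcongr : ∀ {β γ} (hβ : β ∈ realRoots hmn) (hγ : γ ∈ realRoots hmn), β = γ →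
      rootElt b hmn β hβ = rootElt b hmn γ hγ := by
    rintro β γ hβ hγ rfl; rfl
  induction w using (coxeterMatrix m n).toCoxeterSystem.simple_induction_left with
  | one =>
    have h1 : ρ 1 (rootElt b hmn α hα) = rootElt b hmn α hα := by rw [ρ.map_one]; rfl
    exact h1.trans (hcongr _ _ (by rw [map_one]; rfl))
  | mul_simple_left w k ih =>
    exact (algAction_mul ρ (s m k) w _).trans ((congrArg (ρ (s m k)) ih).trans
      ((hρ.root k _ _).trans (hcongr _ _ (by
        change weylDual hmn (s m k) _ = weylDual hmn (s m k * w) α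
        rw [map_mul, Module.End.mul_apply]))))

/-- It suffices to treat s_k with k ≠ n-1. For k = 0 it fixes τ_n since n > m, and for k ≥ 1 its
transposition does not involve n. -/
theorem IsTauAction.τ_of_stabilizes (hρ : IsTauAction b hmn ρ) (hm : 0 < m) (p : Fin n)
    (hp : (p : ℕ) + 1 = n) (w : Weyl m n) (hw : weylRep ℤ hmn w (e ℤ p.succ) = e ℤ p.succ) :
    ρ w (τElt b hmn p) = τElt b hmn p := by
  refine stabilizer_induction hmn hm (P := fun w => ρ w (τElt b hmn p) = τElt b hmn p) p hp
    ?_ (fun w k hk hw => ?_) w hw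
  · rw [ρ.map_one]; rfl
  · refine (algAction_mul ρ w (s m k) _).trans ((congrArg (ρ w) ?_).trans hw)
    by_cases hk0 : (k : ℕ) = 0
    · exact hρ.s_zero_τ_gt k hk0 p (by omega)
    · refine (hρ.s_pos_τ k hk0 p).trans (congrArg _ (adjSwap_of_ne ?_ ?_)) <;> omega

theorem exists_weyl_e (b : Bracket) (hmn : m < n) (p j : Fin n) : ∃ w : Weyl m n,
    weylRep ℤ hmn w (e ℤ p.succ) = e ℤ j.succ ∧
    ∀ ρ : Weyl m n →* (tauField b hmn ≃ₐ[ℂ] tauField b hmn), IsTauAction b hmn ρ →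
      ρ w (τElt b hmn p) = τElt b hmn j := by
  obtain ⟨w, -, -, h1, -, h2⟩ := exists_weyl_perm hmn (Equiv.swap p j)
  refine ⟨w, by rw [h1, Equiv.swap_apply_left], fun ρ hρ => (h2 b ρ hρ p).trans ?_⟩
  exact congrArg _ (Equiv.swap_apply_left p j)

theorem IsTauAction.τ_eq_of_weylRep_eq (hρ : IsTauAction b hmn ρ) (hm : 0 < m) (p : Fin n)
    (hp : (p : ℕ) + 1 = n) (u w : Weyl m n)
    (huw : weylRep ℤ hmn u (e ℤ p.succ) = weylRep ℤ hmn w (e ℤ p.succ)) :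
    ρ u (τElt b hmn p) = ρ w (τElt b hmn p) := by
  have h1 : weylRep ℤ hmn (w⁻¹ * u) (e ℤ p.succ) = e ℤ p.succ := by
    rw [map_mul, Module.End.mul_apply, huw, ← Module.End.mul_apply, ← map_mul, inv_mul_cancel,
      map_one, Module.End.one_apply]
  have h2 := hρ.τ_of_stabilizes hm p hp _ h1
  have h3 : u = w * (w⁻¹ * u) := (mul_inv_cancel_left w u).symm
  have h4 : ρ u (τElt b hmn p) = ρ (w * (w⁻¹ * u)) (τElt b hmn p) :=
    congrArg (fun x => ρ x (τElt b hmn p)) h3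
  exact h4.trans ((algAction_mul ρ _ _ _).trans (congrArg (ρ w) h2))

theorem exists_weyl_of_mem_orbit (hmn : m < n) (p : Fin n) (Λ : orbit hmn) :
    ∃ w : Weyl m n, (Λ : Lat n) = weylRep ℤ hmn w (e ℤ p.succ) := by
  obtain ⟨Λ, w, j, hΛ⟩ := Λ
  obtain ⟨u, -, -, h1, -⟩ := exists_weyl_perm hmn (Equiv.swap p j)
  refine ⟨w * u, ?_⟩
  rw [map_mul, Module.End.mul_apply, h1, Equiv.swap_apply_left]
  exact hΛ

/-- Every element of the orbit is of the form w.e_n, which forces the value; by the stabilizer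
argument it does not depend on the choice of w. -/
theorem existsUnique_latticeTau (hρ : IsTauAction b hmn ρ) (hm : 0 < m) :
    ∃! τ : orbit hmn → tauField b hmn, IsLatticeTau b hmn ρ τ := by
  obtain ⟨p, hp⟩ : ∃ p : Fin n, (p : ℕ) + 1 = n := ⟨⟨n - 1, by omega⟩, by simp only; omega⟩
  choose w hw using exists_weyl_of_mem_orbit hmn p
  refine ⟨fun Λ => ρ (w Λ) (τElt b hmn p), fun u Λ q hq hΛ => ?_, fun τ hτ => funext fun Λ => ?_⟩
  · obtain rfl : q = p := Fin.ext (by omega)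
    exact hρ.τ_eq_of_weylRep_eq hm q hq _ _ ((hw Λ).symm.trans hΛ)
  · exact hτ (w Λ) Λ p hp (hw Λ)

/-- The defining property concerns e_n alone. An element of W realizing a transposition carries e_n
to e_j and τ_n to τ_j, which extends it to all indices. -/
theorem IsLatticeTau.apply {τ : orbit hmn → tauField b hmn} (hτ : IsLatticeTau b hmn ρ τ)
    (hρ : IsTauAction b hmn ρ) (w : Weyl m n) (j : Fin n) (Λ : orbit hmn)
    (hΛ : (Λ : Lat n) = weylRep ℤ hmn w (e ℤ j.succ)) : τ Λ = ρ w (τElt b hmn j) := by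
  obtain ⟨p, hp⟩ : ∃ p : Fin n, (p : ℕ) + 1 = n :=
    ⟨⟨n - 1, by have := j.2; omega⟩, by have := j.2; simp only; omega⟩
  obtain ⟨u, h1, h2⟩ := exists_weyl_e b hmn p j
  have h3 := hτ (w * u) Λ p hp (by rw [map_mul, Module.End.mul_apply, h1, hΛ])
  exact h3.trans ((algAction_mul ρ w u _).trans (congrArg (ρ w) (h2 ρ hρ)))

end LatticeTau

/-! ## The bilinear equations -/

section Bilinear

/-- The group acts on the subfield `T` only, whereas the relation is known in `K`. Injectivity of
`κ` pulls it back to `T`, and then `ψ` can be applied. -/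
theorem three_term_transport {T K : Type*} [Field T] [Field K] (κ ψ : T →+* K)
    {c₁ d₁ u₁ v₁ c₂ d₂ u₂ v₂ c₃ d₃ u₃ v₃ : T} {C₁ D₁ U₁ V₁ C₂ D₂ U₂ V₂ C₃ D₃ U₃ V₃ : K}
    (h : κ c₁ * κ d₁ * κ u₁ * κ v₁ + κ c₂ * κ d₂ * κ u₂ * κ v₂ + κ c₃ * κ d₃ * κ u₃ * κ v₃ = 0)
    (hc₁ : C₁ = ψ c₁) (hd₁ : D₁ = ψ d₁) (hu₁ : U₁ = ψ u₁) (hv₁ : V₁ = ψ v₁)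
    (hc₂ : C₂ = ψ c₂) (hd₂ : D₂ = ψ d₂) (hu₂ : U₂ = ψ u₂) (hv₂ : V₂ = ψ v₂)
    (hc₃ : C₃ = ψ c₃) (hd₃ : D₃ = ψ d₃) (hu₃ : U₃ = ψ u₃) (hv₃ : V₃ = ψ v₃) :
    C₁ * D₁ * U₁ * V₁ + C₂ * D₂ * U₂ * V₂ + C₃ * D₃ * U₃ * V₃ = 0 := by
  simp only [← map_mul, ← map_add] at h
  have h1 := congrArg ψ ((map_eq_zero κ).1 h)
  simp only [map_mul, map_add, map_zero] at h1
  rw [hc₁, hd₁, hu₁, hv₁, hc₂, hd₂, hu₂, hv₂, hc₃, hd₃, hu₃, hv₃, h1]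

/-- The defining formula of `s_m(f_i)` as a three-term relation. -/
theorem three_term_of_formula {K : Type*} [Field K] {A B P Q R S S' t u v F G X : K}
    (hP : P ≠ 0) (hQ : Q ≠ 0) (hv : v ≠ 0) (hS : S' = -S)
    (hX : X = u / v * ((A * S * F - B * R * G) / (P * Q))) :
    R * B * t * (u * G) + S' * A * u * (t * F) + Q * P * v * (t * X) = 0 := by
  rw [hX, hS]
  field_simp
  ring

variable {n : ℕ}

theorem pairing_eq (m : ℕ) {N : ℕ} (l : Fin N → Fin n) :
    pairing m (e ℤ 0 - ∑ a, e ℤ (l a).succ) = ε m 0 - ∑ a, ε m (l a).succ := by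
  have h1 : (fun j => (((e ℤ 0 - ∑ a, e ℤ (l a).succ : Lat n) j : ℤ) : ℂ)) =
      (e ℂ 0 - ∑ a, e ℂ (l a).succ : Cartan n) := by
    funext j
    simp [e, Pi.single_apply]
  rw [pairing, h1, map_sub, map_sum]
  rfl

theorem weylRep_zero_e_point {m : ℕ} (hmn : m < n) (i : Fin m) :
    weylRep ℤ hmn (s m (zeroNode hmn)) (e ℤ (point hmn i).succ) =
      e ℤ (point hmn i).succ + (e ℤ 0 - ∑ t : Fin m, e ℤ (point hmn t).succ) := by
  have h1 : h ℤ m (zeroNode hmn) = e ℤ 0 - ∑ t : Fin m, e ℤ (point hmn t).succ := by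
    rw [h, if_pos (zeroNode_val hmn), sum_point hmn fun j => e ℤ j.succ]
  rw [weylRep_s, form_comm, form_e_succ, h_zero_coord_succ _ (zeroNode_val hmn),
    if_pos (by rw [point_val]; exact i.2), ← h1]
  module

end Bilinear

section HirotaMiwa

theorem injective_vec_three {α : Type*} {x y z : α} (h1 : x ≠ y) (h2 : y ≠ z) (h3 : z ≠ x) :
    Function.Injective ![x, y, z] := by
  intro a c
  fin_cases a <;> fin_cases c <;> simp [h1, h2, h3, h1.symm, h2.symm, h3.symm]

/-- The next to last of the first `M + 2` indices. -/
def penultIndex (M : ℕ) : Fin (M + 2) := (Fin.last M).castSucc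

theorem lastIndex_eq (M : ℕ) : lastIndex (m := M + 2) (Nat.succ_pos (M + 1)) = Fin.last (M + 1) :=
  Fin.ext rfl

theorem penultIndex_ne_last (M : ℕ) : penultIndex M ≠ lastIndex (m := M + 2) (Nat.succ_pos (M + 1)) := by
  intro h0
  have := congrArg Fin.val h0
  simp [penultIndex, lastIndex] at this

theorem sum_fin_add_two {M : ℕ} {A : Type*} [AddCommMonoid A] (g : Fin (M + 2) → A) :
    ∑ t, g t = ∑ a : Fin M, g a.castSucc.castSucc + g (penultIndex M) +
      g (lastIndex (m := M + 2) (Nat.succ_pos (M + 1))) := by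
  rw [Fin.sum_univ_castSucc, Fin.sum_univ_castSucc, lastIndex_eq]
  rfl

variable {M n : ℕ} (hmn : M + 2 < n)

/-- Any choice of distinct indices is moved to standard position by a permutation. -/
theorem exists_standard_perm {i j k : Fin n} {l : Fin M → Fin n} (hij : i ≠ j) (hjk : j ≠ k)
    (hki : k ≠ i) (hl : Function.Injective l) (hli : ∀ a, l a ≠ i) (hlj : ∀ a, l a ≠ j)
    (hlk : ∀ a, l a ≠ k) : ∃ π : Equiv.Perm (Fin n),
      π (point hmn (penultIndex M)) = i ∧
      π (point hmn (lastIndex (m := M + 2) (Nat.succ_pos (M + 1)))) = j ∧ π (branchNode hmn) = k ∧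
      ∀ a, π (point hmn (Fin.castSucc (Fin.castSucc a))) = l a := by
  have hpq : point hmn (penultIndex M) ≠ point hmn (lastIndex (m := M + 2) (Nat.succ_pos (M + 1))) :=
    fun h0 => penultIndex_ne_last M (point_injective hmn h0)
  have h1 : Function.Injective (Sum.elim
      (fun a : Fin M => point hmn (Fin.castSucc (Fin.castSucc a)))
      ![point hmn (penultIndex M), point hmn (lastIndex (m := M + 2) (Nat.succ_pos (M + 1))),
        branchNode hmn]) := by
    refine Function.Injective.sumElim (fun a c hac => ?_)
      (injective_vec_three hpq (CremonaData.point_ne_branch _)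
        (CremonaData.point_ne_branch _).symm) fun a t => ?_
    · have := congrArg Fin.val hac
      rw [point_val, point_val] at this
      exact Fin.ext this
    · intro h0
      have := congrArg Fin.val h0
      have ha := a.2
      fin_cases t <;> simp [point_val, penultIndex, lastIndex_val, branchNode_val] at this <;> omega
  have h2 : Function.Injective (Sum.elim l ![i, j, k]) := by
    refine hl.sumElim (injective_vec_three hij hjk hki) fun a t => ?_
    fin_cases t
    · exact hli a
    · exact hlj a
    · exact hlk a
  obtain ⟨π, hπ⟩ := Equiv.Perm.exists_extending_pair _ _ h1 h2
  exact ⟨π, hπ (Sum.inr 0), hπ (Sum.inr 1), hπ (Sum.inr 2), fun a => hπ (Sum.inl a)⟩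

-- An element w of W moves the standard indices I = m-1, J = m, c = m+1 to i, j, k. The equation is
-- then the image under w of the formula for s_m(f_{m-1}).
set_option maxHeartbeats 2000000 in
theorem bilinear_equation {b : Bracket}
    {ρ : Weyl (M + 2) n →* (tauField b hmn ≃ₐ[ℂ] tauField b hmn)} (hρ : IsTauAction b hmn ρ)
    {τ : orbit hmn → tauField b hmn} (hτ : IsLatticeTau b hmn ρ τ)
    (i j k : Fin n) (l : Fin M → Fin n) (hij : i ≠ j) (hjk : j ≠ k)
    (hki : k ≠ i) (hl : Function.Injective l) (hli : ∀ a, l a ≠ i) (hlj : ∀ a, l a ≠ j)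
    (hlk : ∀ a, l a ≠ k) (Λ : Lat n) (hΛ : Λ = e ℤ 0 - ∑ a, e ℤ (l a).succ) :
    ∃ (hi : Λ - e ℤ i.succ ∈ orbit hmn) (hj : Λ - e ℤ j.succ ∈ orbit hmn)
      (hk : Λ - e ℤ k.succ ∈ orbit hmn),
      b.coeff (M + 2) (ε (M + 2) j.succ - ε (M + 2) k.succ) *
          b.coeff (M + 2) (pairing (M + 2) Λ - ε (M + 2) j.succ - ε (M + 2) k.succ) *
          (τ ⟨e ℤ i.succ, e_mem_orbit hmn i⟩ : Ambient (M + 2) n) *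
          (τ ⟨Λ - e ℤ i.succ, hi⟩ : Ambient (M + 2) n)
        + b.coeff (M + 2) (ε (M + 2) k.succ - ε (M + 2) i.succ) *
          b.coeff (M + 2) (pairing (M + 2) Λ - ε (M + 2) k.succ - ε (M + 2) i.succ) *
          (τ ⟨e ℤ j.succ, e_mem_orbit hmn j⟩ : Ambient (M + 2) n) *
          (τ ⟨Λ - e ℤ j.succ, hj⟩ : Ambient (M + 2) n)
        + b.coeff (M + 2) (ε (M + 2) i.succ - ε (M + 2) j.succ) *
          b.coeff (M + 2) (pairing (M + 2) Λ - ε (M + 2) i.succ - ε (M + 2) j.succ) *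
          (τ ⟨e ℤ k.succ, e_mem_orbit hmn k⟩ : Ambient (M + 2) n) *
          (τ ⟨Λ - e ℤ k.succ, hk⟩ : Ambient (M + 2) n)
        = 0 := by
  have hm : 0 < M + 2 := by omega
  have hb : ((branchNode hmn : Fin n) : ℕ) ≠ 0 := by rw [branchNode_val]; omega
  obtain ⟨π, hπi, hπj, hπk, hπl⟩ := exists_standard_perm hmn hij hjk hki hl hli hlj hlk
  obtain ⟨w, hwε, hwε0, hwe, hwe0, hwτ⟩ := exists_weyl_perm hmn π
  have hpl := penultIndex_ne_last M
  generalize hI : penultIndex M = I at *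
  generalize hJ : lastIndex (m := M + 2) (Nat.succ_pos (M + 1)) = J at *
  generalize hc : branchNode hmn = c at *
  -- the lattice
  obtain ⟨E, hE⟩ : ∃ E : Lat n, E = e ℤ 0 - ∑ a : Fin M,
    e ℤ (point hmn a.castSucc.castSucc).succ := ⟨_, rfl⟩
  have hwE : weylRep ℤ hmn w E = Λ := by
    rw [hE, map_sub, map_sum, hwe0, hΛ]
    simp only [hwe, hπl]
  have hs : ∀ t, weylRep ℤ hmn (s (M + 2) (zeroNode hmn)) (e ℤ (point hmn t).succ) =
      e ℤ (point hmn t).succ + (E - e ℤ (point hmn I).succ - e ℤ (point hmn J).succ) := by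
    intro t
    rw [weylRep_zero_e_point, sum_fin_add_two, hI, hJ, hE]
    abel
  have hIval : (I : ℕ) = M := by rw [← hI]; rfl
  have hcE : weylRep ℤ hmn (s (M + 2) c) E = E := by
    rw [hE, map_sub, map_sum, weylRep_e_zero_pos hmn _ hb]
    congr 1
    refine Finset.sum_congr rfl fun a _ => ?_
    have ha := a.2
    rw [weylRep_e_pos hmn _ hb, ← hc, adjSwap_branch_point hmn hm]
    intro h0
    have := congrArg Fin.val h0
    rw [lastIndex_val, Fin.val_castSucc, Fin.val_castSucc] at this
    omega
  have hcJ : weylRep ℤ hmn (s (M + 2) c) (e ℤ (point hmn J).succ) = e ℤ c.succ := by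
    rw [weylRep_e_pos hmn _ hb, ← hc, ← hJ, adjSwap_branch_last]
  -- The reflection s_0 adds E - e_I - e_J, so e_J goes to E - e_I and e_I to E - e_J: the indices
  -- are crossed.
  have hΛi : Λ - e ℤ i.succ =
      weylRep ℤ hmn (w * s (M + 2) (zeroNode hmn)) (e ℤ (point hmn J).succ) := by
    rw [map_mul, Module.End.mul_apply, hs, ← hwE, ← hπi, ← hwe, ← map_sub]
    congr 1
    abel
  have hΛj : Λ - e ℤ j.succ =
      weylRep ℤ hmn (w * s (M + 2) (zeroNode hmn)) (e ℤ (point hmn I).succ) := by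
    rw [map_mul, Module.End.mul_apply, hs, ← hwE, ← hπj, ← hwe, ← map_sub]
    congr 1
    abel
  -- Applying s_m to s_0.e_I = E - e_J gives E - e_c, since s_m fixes E and exchanges e_J and e_c.
  have hΛk : Λ - e ℤ k.succ = weylRep ℤ hmn (w * (s (M + 2) c * s (M + 2) (zeroNode hmn)))
      (e ℤ (point hmn I).succ) := by
    have h1 : e ℤ (point hmn I).succ + (E - e ℤ (point hmn I).succ - e ℤ (point hmn J).succ) =
        E - e ℤ (point hmn J).succ := by abel
    rw [map_mul, Module.End.mul_apply, map_mul, Module.End.mul_apply, hs, h1, map_sub, hcE, hcJ,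
      map_sub, hwE, hwe, hπk]
  have hi : Λ - e ℤ i.succ ∈ orbit hmn := ⟨_, _, hΛi⟩
  have hj : Λ - e ℤ j.succ ∈ orbit hmn := ⟨_, _, hΛj⟩
  have hk : Λ - e ℤ k.succ ∈ orbit hmn := ⟨_, _, hΛk⟩
  refine ⟨hi, hj, hk, ?_⟩
  -- the roots
  have hcge : M + 2 ≤ (c : ℕ) := by rw [← hc, branchNode_val]
  have hne : ∀ t, point hmn t ≠ c := fun t => by rw [← hc]; exact CremonaData.point_ne_branch t
  have hIJ : point hmn I ≠ point hmn J := fun h0 => hpl (point_injective hmn h0)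
  -- In standard position λ - ε_I - ε_J is α_0; the other two brackets involving λ are then α_0 +
  -- ε_I - ε_c and α_0 + ε_J - ε_c.
  have hroot : weylDual hmn w (simpleRoot (M + 2) (zeroNode hmn)) =
      pairing (M + 2) Λ - ε (M + 2) i.succ - ε (M + 2) j.succ := by
    rw [simpleRoot_zero hmn (zeroNode_val hmn), map_sub, map_sum, sum_fin_add_two, hI, hJ, hΛ,
      pairing_eq]
    simp only [hwε, hwε0, hπi, hπj, hπl]
    abel
  have rJc := ε_sub_mem_realRoots hm hmn (hne J)
  have rcI := ε_sub_mem_realRoots hm hmn (hne I).symm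
  have rIJ := ε_sub_mem_realRoots hm hmn hIJ
  have rI := root_add_mem_realRoots hmn (zeroNode_val hmn) I hcge
  have rJ := root_add_mem_realRoots hmn (zeroNode_val hmn) J hcge
  have r0 := simpleRoot_mem_realRoots hmn (zeroNode hmn)
  have hbr : ∀ {α β} (hα : α ∈ realRoots hmn), weylDual hmn w α = β →
      b.coeff (M + 2) β = (ρ w (rootElt b hmn α hα) : Ambient (M + 2) n) := by
    rintro α β hα rfl
    exact (congrArg Subtype.val (hρ.root_apply w hα)).symm
  have hJm : (J : ℕ) + 1 = M + 2 := by rw [← hJ, lastIndex_val]; omega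
  -- the `τ`-functions
  have hτe : ∀ t : Fin n, τ ⟨e ℤ (π t).succ, e_mem_orbit hmn _⟩ = ρ w (τElt b hmn t) := fun t =>
    hτ.apply hρ w t _ (hwe t).symm
  have hτi : τ ⟨Λ - e ℤ i.succ, hi⟩ = ρ w (τElt b hmn (point hmn J) * fElt b hmn J) :=
    (hτ.apply hρ _ _ _ hΛi).trans ((algAction_mul ρ _ _ _).trans
      (congrArg (ρ w) (hρ.s_zero_τ_le _ rfl J)))
  have hτj : τ ⟨Λ - e ℤ j.succ, hj⟩ = ρ w (τElt b hmn (point hmn I) * fElt b hmn I) :=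
    (hτ.apply hρ _ _ _ hΛj).trans ((algAction_mul ρ _ _ _).trans
      (congrArg (ρ w) (hρ.s_zero_τ_le _ rfl I)))
  have hsτ : ρ (s (M + 2) c) (τElt b hmn (point hmn I)) = τElt b hmn (point hmn I) := by
    refine (hρ.s_pos_τ c hb _).trans (congrArg _ ?_)
    rw [← hc]
    exact adjSwap_branch_point hmn hm (by rw [hJ]; exact hpl)
  have hτk : τ ⟨Λ - e ℤ k.succ, hk⟩ =
      ρ w (τElt b hmn (point hmn I) * ρ (s (M + 2) c) (fElt b hmn I)) := by
    refine (hτ.apply hρ _ _ _ hΛk).trans ((algAction_mul ρ _ _ _).trans (congrArg (ρ w) ?_))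
    refine (algAction_mul ρ _ _ _).trans ((congrArg _ (hρ.s_zero_τ_le _ rfl I)).trans ?_)
    exact (map_mul (ρ (s (M + 2) c)) _ _).trans (congrArg (· * _) hsτ)
  subst hπi hπj hπk
  -- Here κ is the inclusion of 𝓛, and ψ is that inclusion after the action of w.
  refine three_term_transport (T := tauField b hmn) (K := Ambient (M + 2) n)
    (algebraMap (tauField b hmn) (Ambient (M + 2) n))
    ((algebraMap (tauField b hmn) (Ambient (M + 2) n)).comp
      ((ρ w).toAlgHom.toRingHom : tauField b hmn →+* tauField b hmn))
    (three_term_of_formula (K := Ambient (M + 2) n)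
      (b.coeff_ne_zero (n := n) (M + 2) (simpleRoot_zero_ne_zero hmn (zeroNode hmn)))
      (b.coeff_ne_zero (n := n) (M + 2) (ε_sub_ne_zero hIJ)) (τVar_ne_zero (m := M + 2) c)
      ((congrArg (b.coeff (M + 2)) (neg_sub _ _).symm).trans (b.coeff_neg (M + 2) _))
      (hρ.s_m_f (zeroNode hmn) c rfl (by rw [← hc]; rfl) J hJm I hpl))
    (c₁ := rootElt b hmn _ rJc) (d₁ := rootElt b hmn _ rI) (u₁ := τElt b hmn (point hmn I))
    (v₁ := τElt b hmn (point hmn J) * fElt b hmn J)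
    (c₂ := rootElt b hmn _ rcI) (d₂ := rootElt b hmn _ rJ) (u₂ := τElt b hmn (point hmn J))
    (v₂ := τElt b hmn (point hmn I) * fElt b hmn I)
    (c₃ := rootElt b hmn _ rIJ) (d₃ := rootElt b hmn _ r0) (u₃ := τElt b hmn c)
    (v₃ := τElt b hmn (point hmn I) * ρ (s (M + 2) c) (fElt b hmn I))
    (hbr _ ?_) (hbr _ ?_) (congrArg Subtype.val (hτe _)) (congrArg Subtype.val hτi)
    (hbr _ ?_) (hbr _ ?_) (congrArg Subtype.val (hτe _)) (congrArg Subtype.val hτj)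
    (hbr _ ?_) (hbr _ ?_) (congrArg Subtype.val (hτe _)) (congrArg Subtype.val hτk)
  · rw [map_sub, hwε, hwε]
  · rw [map_add, hroot, map_sub, hwε, hwε]; abel
  · rw [map_sub, hwε, hwε]
  · rw [map_add, hroot, map_sub, hwε, hwε]; abel
  · rw [map_sub, hwε, hwε]
  · exact hroot

end HirotaMiwa

end

end EllipticCremona

set_option maxHeartbeats 2000000 in
theorem mainTheorem1 (m n : ℕ) (hm : 3 ≤ m) (hmn : m < n) (b : EllipticCremona.Bracket) :
    -- The formulas for the simple reflections define an action of the Weyl group on `𝓛`.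
    (∃! ρ : EllipticCremona.Weyl m n →*
        (EllipticCremona.tauField b hmn ≃ₐ[ℂ] EllipticCremona.tauField b hmn),
      EllipticCremona.IsTauAction b hmn ρ) ∧
    ∀ ρ : EllipticCremona.Weyl m n →*
        (EllipticCremona.tauField b hmn ≃ₐ[ℂ] EllipticCremona.tauField b hmn),
      EllipticCremona.IsTauAction b hmn ρ →
      -- The lattice `τ`-functions are well defined,
      (∃! τ : EllipticCremona.orbit hmn → EllipticCremona.tauField b hmn,
        EllipticCremona.IsLatticeTau b hmn ρ τ) ∧
      -- and they satisfy the bilinear equations of Hirota-Miwa type.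
      ∀ τ : EllipticCremona.orbit hmn → EllipticCremona.tauField b hmn,
        EllipticCremona.IsLatticeTau b hmn ρ τ →
        ∀ (i j k : Fin n) (l : Fin (m - 2) → Fin n),
          i ≠ j → j ≠ k → k ≠ i → Function.Injective l →
          (∀ a, l a ≠ i) → (∀ a, l a ≠ j) → (∀ a, l a ≠ k) →
          ∀ Λ : EllipticCremona.Lat n,
            Λ = EllipticCremona.e ℤ 0 - ∑ a, EllipticCremona.e ℤ (l a).succ →
            ∃ (hi : Λ - EllipticCremona.e ℤ i.succ ∈ EllipticCremona.orbit hmn)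
              (hj : Λ - EllipticCremona.e ℤ j.succ ∈ EllipticCremona.orbit hmn)
              (hk : Λ - EllipticCremona.e ℤ k.succ ∈ EllipticCremona.orbit hmn),
              b.coeff m (EllipticCremona.ε m j.succ - EllipticCremona.ε m k.succ) *
                  b.coeff m (EllipticCremona.pairing m Λ - EllipticCremona.ε m j.succ
                    - EllipticCremona.ε m k.succ) *
                  (τ ⟨EllipticCremona.e ℤ i.succ, EllipticCremona.e_mem_orbit hmn i⟩ :
                    EllipticCremona.Ambient m n) *
                  (τ ⟨Λ - EllipticCremona.e ℤ i.succ, hi⟩ : EllipticCremona.Ambient m n)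
                + b.coeff m (EllipticCremona.ε m k.succ - EllipticCremona.ε m i.succ) *
                  b.coeff m (EllipticCremona.pairing m Λ - EllipticCremona.ε m k.succ
                    - EllipticCremona.ε m i.succ) *
                  (τ ⟨EllipticCremona.e ℤ j.succ, EllipticCremona.e_mem_orbit hmn j⟩ :
                    EllipticCremona.Ambient m n) *
                  (τ ⟨Λ - EllipticCremona.e ℤ j.succ, hj⟩ : EllipticCremona.Ambient m n)
                + b.coeff m (EllipticCremona.ε m i.succ - EllipticCremona.ε m j.succ) *
                  b.coeff m (EllipticCremona.pairing m Λ - EllipticCremona.ε m i.succ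
                    - EllipticCremona.ε m j.succ) *
                  (τ ⟨EllipticCremona.e ℤ k.succ, EllipticCremona.e_mem_orbit hmn k⟩ :
                    EllipticCremona.Ambient m n) *
                  (τ ⟨Λ - EllipticCremona.e ℤ k.succ, hk⟩ : EllipticCremona.Ambient m n)
                = 0 := by 
  -- With this form of m the type `Fin (m - 2)` reduces to `Fin M`, so `l` needs no cast.
  obtain ⟨M, rfl⟩ : ∃ M, m = M + 2 := ⟨m - 2, by omega⟩
  have hm0 : 0 < M + 2 := by omega
  obtain ⟨ρ, hρ⟩ := EllipticCremona.exists_tauAction b hmn hm0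
  refine ⟨⟨ρ, hρ, fun ρ' hρ' => EllipticCremona.tauAction_unique b hmn hm0 hρ' hρ⟩,
    fun ρ hρ => ⟨EllipticCremona.existsUnique_latticeTau hρ hm0, ?_⟩⟩
  intro τ hτ i j k l hij hjk hki hl hli hlj hlk Λ hΛ
  exact EllipticCremona.bilinear_equation hmn hρ hτ i j k l hij hjk hki hl hli hlj hlk Λ hΛ
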